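/- Let $K$ be a field and $Q$ a finite quiver without oriented cycles. A representation of $Q$ means a finite-dimensional representation over $K$, and $R(Q)$ is the representation ring: the free abelian group on isomorphism classes of representations modulo all $[V\oplus W]-[V]-[W]$, with product induced by the pointwise tensor product. A quiver over $Q$ is a finite quiver $Q'$ with a morphism of quivers $f'\colon Q'\to Q$; morphisms of quivers over $Q$ are those commuting with the structure maps. The linearization $L(Q',f')$ is the pushforward $f'_*\mathbb 1_{Q'}$ of the identity representation: its space at a vertex $x$ has basis $\{e_y : f'(y)=x\}$, and an arrow $\alpha$ acts by $e_y\mapsto\sum_{\beta} e_{t(\beta)}$, the sum being over the arrows $\beta$ of $Q'$ with $f'(\beta)=\alpha$ and $s(\beta)=y$. For a subquiver $T\subseteq Q$: - if $T$ has a unique source $i$, let $P_T$ be the quiver over $Q$ whose vertices are the paths in $T$ starting at $i$, each lying over its end point, with one arrow $p\to p\alpha$ over $\alpha$ for each such path $p$ and each arrow $\alpha$ of $T$ starting at the end point of $p$; - if $T$ has a unique sink, let $I_T$ be the dual construction on the paths in $T$ ending at the sink; - if $T$ is connected (in particular nonempty), let $E_T$ be the inclusion $T\hookrightarrow Q$.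 Let $\mathrm{PIE}$ be the full subcategory of the category of quivers over $Q$ whose objects are all these $P_T$, $I_T$, $E_T$, where objects isomorphic over $Q$ are identified. **Theorem.** 1. $\mathrm{PIE}$ is an acyclic category (the only endomorphisms are identities, and only identities are invertible). Its objects are connected quivers, and their structure maps are wrappings, i.e. injective on each set of parallel arrows. The fiber product over $Q$ of two objects of $\mathrm{PIE}$ is a (possibly empty) disjoint union of objects of $\mathrm{PIE}$. For every object $x$ the representation $L(x)$ is indecomposable, and $L(x)\not\simeq L(y)$ for distinct objects $x\neq y$. 2. $L(P_T)$ is an indecomposable subprojective representation (its restriction to its support is projective), $L(I_T)$ is an indecomposable subinjective representation (its restriction to its support is injective), and $L(E_T)$ is an indecomposable idempotent representation (its restriction to its support is the identity representation), whenever these objects are defined. 3. Write $[x,y]$ for the number of morphisms $x\to y$ in $\mathrm{PIE}$. The matrix $([x,y])_{x,y}$ is invertible over $\mathbb Z$; its inverse $\mu$, the Möbius function of $\mathrm{PIE}$, satisfies $\mu(x,x)=1$, $\sum_z [x,z]\mu(z,x)=1$, and $\sum_z [x,z]\mu(z,y)=0$ for $x\ne y$. For each object $x$ let $\delta_x=\sum_z\mu(z,x)\,z$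 in the free abelian group on the objects of $\mathrm{PIE}$ and let $e_x=L(\delta_x)=\sum_z \mu(z,x)\,L(z)\in R(Q)$. Every $e_x$ is idempotent, and $r\mapsto (r e_x)_x$ is an isomorphism of rings $$R(Q)\;\cong\;\prod_{x\in \mathrm{PIE}_0}\langle e_x\rangle ,$$ where $\langle e_x\rangle$ is the principal ideal of $R(Q)$ generated by $e_x$. -/

import Mathlib

open CategoryTheory

open scoped TensorProduct

universe u

namespace QuiverRep

/-! ## Finite quivers -/

/-- A (finite) quiver `(Q₀, Q₁, s, t)`. -/
structure FinQuiver : Type (u + 1) where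
  V : Type u
  A : Type u
  s : A → V
  t : A → V
  finV : Finite V
  finA : Finite A

attribute [instance] FinQuiver.finV FinQuiver.finA

namespace FinQuiver

/-- Morphisms of quivers. -/
@[ext]
structure Hom (Q R : FinQuiver.{u}) : Type u where
  onV : Q.V → R.V
  onA : Q.A → R.A
  s_onA : ∀ a, R.s (onA a) = onV (Q.s a)
  t_onA : ∀ a, R.t (onA a) = onV (Q.t a)

/-- The identity morphism. -/
def Hom.id (Q : FinQuiver.{u}) : Hom Q Q := ⟨fun v => v, fun a => a, fun _ => rfl, fun _ => rfl⟩

/-- Composition of morphisms: first `f`, then `g`. -/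
def Hom.comp {Q R S : FinQuiver.{u}} (f : Hom Q R) (g : Hom R S) : Hom Q S where
  onV v := g.onV (f.onV v)
  onA a := g.onA (f.onA a)
  s_onA a := by rw [g.s_onA, f.s_onA]
  t_onA a := by rw [g.t_onA, f.t_onA]

/-- `Q.IsPath i l j`: the list of arrows `l` is a path from `i` to `j`
(the empty list is the trivial path). -/
inductive IsPath (Q : FinQuiver.{u}) (i : Q.V) : List Q.A → Q.V → Prop
  | nil : IsPath Q i [] i
  | snoc {l : List Q.A} (a : Q.A) : IsPath Q i l (Q.s a) → IsPath Q i (l ++ [a]) (Q.t a)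

/-- A quiver without oriented cycles. -/
class IsAcyclic (Q : FinQuiver.{u}) : Prop where
  eq_nil : ∀ (i : Q.V) (l : List Q.A), Q.IsPath i l i → l = []

/-- A connected quiver: nonempty, with connected underlying undirected graph. -/
def IsConnected (Q : FinQuiver.{u}) : Prop :=
  Nonempty Q.V ∧ ∀ v w : Q.V, Relation.EqvGen (fun x y => ∃ a, Q.s a = x ∧ Q.t a = y) v w

/-- `i` is a source (no arrow ends at `i`) and it is the only one. -/
def IsUniqueSource (Q : FinQuiver.{u}) (i : Q.V) : Prop :=
  ∀ v : Q.V, (∀ a, Q.t a ≠ v) ↔ v = i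

/-- `i` is a sink (no arrow starts at `i`) and it is the only one. -/
def IsUniqueSink (Q : FinQuiver.{u}) (i : Q.V) : Prop :=
  ∀ v : Q.V, (∀ a, Q.s a ≠ v) ↔ v = i

/-- The opposite quiver. -/
def op (Q : FinQuiver.{u}) : FinQuiver.{u} := ⟨Q.V, Q.A, Q.t, Q.s, Q.finV, Q.finA⟩

/-! Paths in acyclic quivers: there are finitely many of them. -/

theorem IsPath.append {Q : FinQuiver.{u}} {i j k : Q.V} {l m : List Q.A} (h : Q.IsPath i l j)
    (h2 : Q.IsPath j m k) : Q.IsPath i (l ++ m) k := by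
  induction h2 with
  | nil => simpa using h
  | snoc a _ ih => rw [← List.append_assoc]; exact IsPath.snoc a ih

theorem IsPath.op_reverse {Q : FinQuiver.{u}} {i j : Q.V} {l : List Q.A} (h : Q.IsPath i l j) :
    Q.op.IsPath j l.reverse i := by
  induction h with
  | nil => exact IsPath.nil
  | snoc a _ ih =>
    rw [List.reverse_append]
    exact IsPath.append (Q := Q.op) (IsPath.snoc (Q := Q.op) (l := []) a IsPath.nil) ih

instance (Q : FinQuiver.{u}) [hQ : Q.IsAcyclic] : Q.op.IsAcyclic where
  eq_nil i l h := by
    have h2 : Q.IsPath i l.reverse i := IsPath.op_reverse h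
    exact List.reverse_eq_nil_iff.1 (hQ.eq_nil i _ h2)

theorem IsPath.split {Q : FinQuiver.{u}} {i j : Q.V} {l : List Q.A} (h : Q.IsPath i l j)
    {a : Q.A} (ha : a ∈ l) : ∃ m, Q.IsPath (Q.s a) (a :: m) j := by
  induction h with
  | nil => simp at ha
  | snoc b _ ih =>
    rcases List.mem_append.1 ha with h1 | h1
    · obtain ⟨m, hm⟩ := ih h1
      exact ⟨m ++ [b], IsPath.snoc b hm⟩
    · obtain rfl : a = b := by simpa using h1
      exact ⟨[], IsPath.snoc (l := []) a IsPath.nil⟩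

theorem IsPath.nodup {Q : FinQuiver.{u}} [hQ : Q.IsAcyclic] {i j : Q.V} {l : List Q.A}
    (h : Q.IsPath i l j) : l.Nodup := by
  induction h with
  | nil => simp
  | snoc a hl ih =>
    rw [List.nodup_append]
    refine ⟨ih, by simp, ?_⟩
    rintro b hb c hc rfl
    obtain rfl : b = a := by simpa using hc
    obtain ⟨m, hm⟩ := hl.split hb
    simpa using hQ.eq_nil _ _ hm

theorem finite_paths (Q : FinQuiver.{u}) [Q.IsAcyclic] (i : Q.V) :
    Finite {p : List Q.A × Q.V // Q.IsPath i p.1 p.2} := by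
  classical
  let _ := Fintype.ofFinite Q.A
  have h : {l : List Q.A | l.Nodup}.Finite := by
    refine (List.finite_length_le Q.A (Fintype.card Q.A)).subset ?_
    intro l hl
    exact List.Nodup.length_le_card hl
  have : Finite {l : List Q.A // l.Nodup} := h
  refine Finite.of_injective
    (β := {l : List Q.A // l.Nodup} × Q.V) (fun p => (⟨p.1.1, p.2.nodup⟩, p.1.2)) ?_
  rintro ⟨⟨l, v⟩, hp⟩ ⟨⟨m, w⟩, hq⟩ h
  simp only [Prod.mk.injEq, Subtype.mk.injEq] at h
  obtain ⟨rfl, rfl⟩ := h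
  rfl

end FinQuiver

/-! ## Subquivers -/

/-- A subquiver: a set of vertices and a set of arrows between them. -/
@[ext]
structure Subquiver (Q : FinQuiver.{u}) : Type u where
  verts : Set Q.V
  arrows : Set Q.A
  s_mem : ∀ a ∈ arrows, Q.s a ∈ verts
  t_mem : ∀ a ∈ arrows, Q.t a ∈ verts

namespace Subquiver

variable {Q : FinQuiver.{u}}

/-- A subquiver, as a quiver. -/
def toFinQuiver (T : Subquiver Q) : FinQuiver.{u} where
  V := T.verts
  A := T.arrows
  s a := ⟨Q.s a.1, T.s_mem a.1 a.2⟩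
  t a := ⟨Q.t a.1, T.t_mem a.1 a.2⟩
  finV := inferInstance
  finA := inferInstance

/-- The inclusion `T → Q`. -/
def incl (T : Subquiver Q) : FinQuiver.Hom T.toFinQuiver Q :=
  ⟨Subtype.val, Subtype.val, fun _ => rfl, fun _ => rfl⟩

theorem isPath_map (T : Subquiver Q) {i j : T.toFinQuiver.V} {l : List T.toFinQuiver.A}
    (h : T.toFinQuiver.IsPath i l j) : Q.IsPath i.1 (l.map T.incl.onA) j.1 := by
  induction h with
  | nil => exact FinQuiver.IsPath.nil
  | snoc a _ ih =>
    rw [List.map_append]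
    exact FinQuiver.IsPath.snoc (T.incl.onA a) ih

instance (T : Subquiver Q) [hQ : Q.IsAcyclic] : T.toFinQuiver.IsAcyclic where
  eq_nil i l h := by simpa using hQ.eq_nil _ _ (T.isPath_map h)

end Subquiver

/-! ## The category of quivers over `Q` -/

/-- A quiver over `Q`: a quiver with a structure map to `Q`. -/
structure OverQ (Q : FinQuiver.{u}) : Type (u + 1) where
  quiv : FinQuiver.{u}
  str : FinQuiver.Hom quiv Q

namespace OverQ

variable {Q : FinQuiver.{u}}

/-- Morphisms of quivers over `Q`: those commuting with the structure maps. -/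
@[ext]
structure Hom (X Y : OverQ Q) : Type u where
  hom : FinQuiver.Hom X.quiv Y.quiv
  comm : hom.comp Y.str = X.str

instance : Category.{u} (OverQ Q) where
  Hom := Hom
  id X := ⟨FinQuiver.Hom.id X.quiv, rfl⟩
  comp f g := ⟨f.hom.comp g.hom, by rw [← f.comm, ← g.comm]; rfl⟩

/-- The fiber product of two quivers over `Q`. -/
def fiberProd (X Y : OverQ Q) : OverQ Q where
  quiv :=
    { V := {p : X.quiv.V × Y.quiv.V // X.str.onV p.1 = Y.str.onV p.2}
      A := {p : X.quiv.A × Y.quiv.A // X.str.onA p.1 = Y.str.onA p.2}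
      s := fun p => ⟨(X.quiv.s p.1.1, Y.quiv.s p.1.2), by
        rw [← X.str.s_onA, ← Y.str.s_onA, p.2]⟩
      t := fun p => ⟨(X.quiv.t p.1.1, Y.quiv.t p.1.2), by
        rw [← X.str.t_onA, ← Y.str.t_onA, p.2]⟩
      finV := inferInstance
      finA := inferInstance }
  str :=
    { onV := fun p => X.str.onV p.1.1
      onA := fun p => X.str.onA p.1.1
      s_onA := fun p => X.str.s_onA p.1.1
      t_onA := fun p => X.str.t_onA p.1.1 }

/-- The disjoint union of finitely many quivers over `Q`. -/
def disjointUnion {n : ℕ} (w : Fin n → OverQ Q) : OverQ Q where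
  quiv :=
    { V := Σ k, (w k).quiv.V
      A := Σ k, (w k).quiv.A
      s := fun a => ⟨a.1, (w a.1).quiv.s a.2⟩
      t := fun a => ⟨a.1, (w a.1).quiv.t a.2⟩
      finV := inferInstance
      finA := inferInstance }
  str :=
    { onV := fun v => (w v.1).str.onV v.2
      onA := fun a => (w a.1).str.onA a.2
      s_onA := fun a => (w a.1).str.s_onA a.2
      t_onA := fun a => (w a.1).str.t_onA a.2 }

/-- The structure map does not identify distinct parallel arrows. -/
def IsWrapping (X : OverQ Q) : Prop :=
  ∀ a b : X.quiv.A, X.quiv.s a = X.quiv.s b → X.quiv.t a = X.quiv.t b →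
    X.str.onA a = X.str.onA b → a = b

/-- View a quiver over `R` as a quiver over `Q`, along `f : R → Q`. -/
def along {R : FinQuiver.{u}} (X : OverQ R) (f : FinQuiver.Hom R Q) : OverQ Q :=
  ⟨X.quiv, X.str.comp f⟩

/-- Reverse all arrows of a quiver over the opposite of `Q`. -/
def unop (X : OverQ Q.op) : OverQ Q where
  quiv := X.quiv.op
  str := ⟨X.str.onV, X.str.onA, X.str.t_onA, X.str.s_onA⟩

end OverQ

/-! ## The objects `P_T`, `I_T`, `E_T` -/

/-- The quiver over `Q` whose vertices are the paths `p` of `Q` starting at `i`, lying over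
their end points, with one arrow `p → pα` over `α` for each path `p` and each arrow `α` of `Q`
starting at the end point of `p`. -/
def pathSpace (Q : FinQuiver.{u}) [Q.IsAcyclic] (i : Q.V) : OverQ Q where
  quiv :=
    { V := {p : List Q.A × Q.V // Q.IsPath i p.1 p.2}
      A := {x : {p : List Q.A × Q.V // Q.IsPath i p.1 p.2} × Q.A // x.1.1.2 = Q.s x.2}
      s := fun x => x.1.1
      t := fun x => ⟨(x.1.1.1.1 ++ [x.1.2], Q.t x.1.2),
        FinQuiver.IsPath.snoc x.1.2 (x.2 ▸ x.1.1.2)⟩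
      finV := Q.finite_paths i
      finA := by
        have := Q.finite_paths i
        infer_instance }
  str :=
    { onV := fun p => p.1.2
      onA := fun x => x.1.2
      s_onA := fun x => x.2.symm
      t_onA := fun _ => rfl }

section PIE

variable {Q : FinQuiver.{u}}

/-- `P_T`, to be used when `i` is the unique source of `T`. -/
def objP [Q.IsAcyclic] (T : Subquiver Q) (i : T.toFinQuiver.V) : OverQ Q :=
  (pathSpace T.toFinQuiver i).along T.incl

/-- `I_T`, to be used when `i` is the unique sink of `T`: the dual of `P_T`, so its vertices
are the paths in `T` ending at `i` (recorded backwards, as paths of the opposite quiver). -/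
def objI [Q.IsAcyclic] (T : Subquiver Q) (i : T.toFinQuiver.V) : OverQ Q :=
  (OverQ.unop (Q := T.toFinQuiver) (pathSpace T.toFinQuiver.op i)).along T.incl

/-- `E_T`: the inclusion of `T` into `Q`. -/
def objE (T : Subquiver Q) : OverQ Q := ⟨T.toFinQuiver, T.incl⟩

/-- The quivers `P_T` (`T` with a unique source), `I_T` (`T` with a unique sink) and
`E_T` (`T` connected) over `Q`. -/
inductive IsPIE (Q : FinQuiver.{u}) [Q.IsAcyclic] : OverQ Q → Prop
  | P (T : Subquiver Q) (i : T.toFinQuiver.V) (h : T.toFinQuiver.IsUniqueSource i) :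
      IsPIE Q (objP T i)
  | I (T : Subquiver Q) (i : T.toFinQuiver.V) (h : T.toFinQuiver.IsUniqueSink i) :
      IsPIE Q (objI T i)
  | E (T : Subquiver Q) (h : T.toFinQuiver.IsConnected) : IsPIE Q (objE T)

/-- The PIE category: the full subcategory of quivers over `Q` on the `P_T`, `I_T`, `E_T`,
where isomorphic quivers over `Q` count as one object. -/
abbrev PIE (Q : FinQuiver.{u}) [Q.IsAcyclic] : Type (u + 1) :=
  Skeleton (ObjectProperty.FullSubcategory (C := OverQ Q) (IsPIE Q))

/-- The inclusion of the PIE category into the category of quivers over `Q`. -/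
noncomputable abbrev PIE.incl (Q : FinQuiver.{u}) [Q.IsAcyclic] : PIE Q ⥤ OverQ Q :=
  fromSkeleton _ ⋙ ObjectProperty.ι (C := OverQ Q) (IsPIE Q)

instance (T : FinQuiver.{u}) : Finite (Subquiver T) :=
  Finite.of_injective (fun S : Subquiver T => (S.verts, S.arrows)) (by
    intro S S2 h
    simp only [Prod.mk.injEq] at h
    exact Subquiver.ext h.1 h.2)

instance PIE.finite (Q : FinQuiver.{u}) [Q.IsAcyclic] : Finite (PIE Q) := by
  have h : {X : OverQ Q | IsPIE Q X}.Finite := by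
    have h1 : (Set.range fun x : (Σ T : Subquiver Q, T.toFinQuiver.V) => objP x.1 x.2).Finite :=
      Set.finite_range _
    have h2 : (Set.range fun x : (Σ T : Subquiver Q, T.toFinQuiver.V) => objI x.1 x.2).Finite :=
      Set.finite_range _
    have h3 : (Set.range fun T : Subquiver Q => objE T).Finite := Set.finite_range _
    refine ((h1.union h2).union h3).subset ?_
    rintro X hX
    cases hX with
    | P T i h => exact Or.inl (Or.inl ⟨⟨T, i⟩, rfl⟩)
    | I T i h => exact Or.inl (Or.inr ⟨⟨T, i⟩, rfl⟩)
    | E T h => exact Or.inr ⟨T, rfl⟩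
  have : Finite {X : OverQ Q // IsPIE Q X} := h
  have : Finite (ObjectProperty.FullSubcategory (C := OverQ Q) (IsPIE Q)) :=
    Finite.of_injective (β := {X : OverQ Q // IsPIE Q X}) (fun X => ⟨X.obj, X.property⟩) (by
      rintro ⟨X, hX⟩ ⟨Y, hY⟩ h
      simp only [Subtype.mk.injEq] at h
      subst h
      rfl)
  exact Quotient.finite _

end PIE

/-! ## Representations -/

/-- A (finite-dimensional) representation of `Q` over `K`. -/
structure Rep (K : Type u) [Field K] (Q : FinQuiver.{u}) : Type (u + 1) where
  sp : Q.V → Type u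
  [acg : ∀ x, AddCommGroup (sp x)]
  [mod : ∀ x, Module K (sp x)]
  [fin : ∀ x, FiniteDimensional K (sp x)]
  map : ∀ a : Q.A, sp (Q.s a) →ₗ[K] sp (Q.t a)

attribute [instance] Rep.acg Rep.mod Rep.fin

namespace Rep

variable {K : Type u} [Field K] {Q : FinQuiver.{u}}

/-- Morphisms of representations. -/
structure Hom (V W : Rep K Q) : Type u where
  app : ∀ x, V.sp x →ₗ[K] W.sp x
  comm : ∀ a v, app (Q.t a) (V.map a v) = W.map a (app (Q.s a) v)

/-- Isomorphisms of representations. -/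
structure Iso (V W : Rep K Q) : Type u where
  app : ∀ x, V.sp x ≃ₗ[K] W.sp x
  comm : ∀ a v, app (Q.t a) (V.map a v) = W.map a (app (Q.s a) v)

/-- The identity isomorphism. -/
def Iso.refl (V : Rep K Q) : Iso V V := ⟨fun _ => LinearEquiv.refl K _, fun _ _ => rfl⟩

/-- The inverse isomorphism. -/
def Iso.symm {V W : Rep K Q} (e : Iso V W) : Iso W V :=
  ⟨fun x => (e.app x).symm, fun a w => by
    rw [LinearEquiv.symm_apply_eq, e.comm, LinearEquiv.apply_symm_apply]⟩

/-- Composition of isomorphisms. -/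
def Iso.trans {V W U : Rep K Q} (e : Iso V W) (f : Iso W U) : Iso V U :=
  ⟨fun x => (e.app x).trans (f.app x), fun a v => by
    simp only [LinearEquiv.trans_apply, e.comm, f.comm]⟩

/-- Isomorphism, as an equivalence relation. -/
instance setoid (K : Type u) [Field K] (Q : FinQuiver.{u}) : Setoid (Rep K Q) where
  r V W := Nonempty (Iso V W)
  iseqv := ⟨fun V => ⟨Iso.refl V⟩, fun ⟨e⟩ => ⟨e.symm⟩, fun ⟨e⟩ ⟨f⟩ => ⟨e.trans f⟩⟩

/-- The direct sum. -/
abbrev dsum (V W : Rep K Q) : Rep K Q where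
  sp x := V.sp x × W.sp x
  map a := (V.map a).prodMap (W.map a)

/-- The pointwise tensor product. -/
noncomputable abbrev tensor (V W : Rep K Q) : Rep K Q where
  sp x := V.sp x ⊗[K] W.sp x
  map a := TensorProduct.map (V.map a) (W.map a)

/-- The identity representation: `K` at each vertex, the identity map over each arrow. -/
abbrev one (K : Type u) [Field K] (Q : FinQuiver.{u}) : Rep K Q where
  sp _ := K
  map _ := LinearMap.id

/-- The zero representation. -/
def IsZero (V : Rep K Q) : Prop := ∀ x, Subsingleton (V.sp x)

/-- Indecomposable representations. -/
def IsIndecomposable (V : Rep K Q) : Prop :=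
  ¬ V.IsZero ∧ ∀ A B : Rep K Q, Nonempty (Iso V (A.dsum B)) → A.IsZero ∨ B.IsZero

/-- Projective representations: maps out of `V` lift along surjections. -/
def IsProjective (V : Rep K Q) : Prop :=
  ∀ (A B : Rep K Q) (g : Hom A B) (f : Hom V B), (∀ x, Function.Surjective (g.app x)) →
    ∃ h : Hom V A, ∀ x v, g.app x (h.app x v) = f.app x v

/-- Injective representations: maps into `V` extend along injections. -/
def IsInjective (V : Rep K Q) : Prop :=
  ∀ (A B : Rep K Q) (g : Hom A B) (f : Hom A V), (∀ x, Function.Injective (g.app x)) →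
    ∃ h : Hom B V, ∀ x v, h.app x (g.app x v) = f.app x v

/-- The support: vertices with nonzero space and arrows with nonzero map. -/
def support (V : Rep K Q) : Subquiver Q where
  verts := {x | Nontrivial (V.sp x)}
  arrows := {a | V.map a ≠ 0}
  s_mem a ha := by
    by_contra h
    have h2 : Subsingleton (V.sp (Q.s a)) := not_nontrivial_iff_subsingleton.1 h
    exact ha (LinearMap.ext fun v => by rw [Subsingleton.elim v 0, map_zero, map_zero])
  t_mem a ha := by
    by_contra h
    have h2 : Subsingleton (V.sp (Q.t a)) := not_nontrivial_iff_subsingleton.1 h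
    exact ha (LinearMap.ext fun v => Subsingleton.elim _ _)

/-- Restriction to a subquiver. -/
abbrev restrict (V : Rep K Q) (T : Subquiver Q) : Rep K T.toFinQuiver where
  sp x := V.sp x.1
  map a := V.map a.1

/-- The restriction of `V` to its support is projective. -/
def IsSubprojective (V : Rep K Q) : Prop := (V.restrict V.support).IsProjective

/-- The restriction of `V` to its support is injective. -/
def IsSubinjective (V : Rep K Q) : Prop := (V.restrict V.support).IsInjective

/-- `V` is (up to isomorphism) the identity representation of a subquiver, extended by zero;
that is, the restriction of `V` to its support is the identity representation. -/
def IsIdempotentRep (V : Rep K Q) : Prop :=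
  Nonempty (Iso (V.restrict V.support) (one K V.support.toFinQuiver))

open Classical in
/-- The pushforward of `V` along `f : R → Q`: the space at `x` is the direct sum of the `V_y`
over the vertices `y` above `x`, and the map of `a` is the sum of the maps of the arrows `b`
above `a`, each going from the summand of its start to the summand of its end. -/
noncomputable def pushforward {R : FinQuiver.{u}} (f : FinQuiver.Hom R Q) (V : Rep K R) :
    Rep K Q where
  sp x := (y : {y : R.V // f.onV y = x}) → V.sp y.1
  map a :=
    letI := Fintype.ofFinite {b : R.A // f.onA b = a}
    ∑ b : {b : R.A // f.onA b = a},
      (LinearMap.single K (fun y : {y : R.V // f.onV y = Q.t a} => V.sp y.1)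
        ⟨R.t b.1, by rw [← f.t_onA, b.2]⟩) ∘ₗ (V.map b.1) ∘ₗ
      (LinearMap.proj (φ := fun y : {y : R.V // f.onV y = Q.s a} => V.sp y.1)
        ⟨R.s b.1, by rw [← f.s_onA, b.2]⟩)

end Rep

/-- The linearization of a quiver over `Q`. -/
noncomputable def linearization (K : Type u) [Field K] {Q : FinQuiver.{u}} (X : OverQ Q) :
    Rep K Q :=
  Rep.pushforward X.str (Rep.one K X.quiv)

/-! ## The representation ring -/

section RepRing

variable (K : Type u) [Field K] (Q : FinQuiver.{u})

/-- Isomorphism classes of representations. -/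
def IsoClass : Type (u + 1) := Quotient (Rep.setoid K Q)

variable {K Q}

/-- The isomorphism class of a representation. -/
def Rep.cls (V : Rep K Q) : IsoClass K Q := Quotient.mk _ V

/-- Tensor product of isomorphisms. -/
noncomputable def Rep.Iso.tensor {V V2 W W2 : Rep K Q} (e : Iso V V2) (f : Iso W W2) :
    Iso (V.tensor W) (V2.tensor W2) where
  app x := TensorProduct.congr (e.app x) (f.app x)
  comm a v := by
    refine LinearMap.congr_fun (f := (TensorProduct.congr (e.app _) (f.app _)).toLinearMap ∘ₗ
      TensorProduct.map (V.map a) (W.map a))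
      (g := TensorProduct.map (V2.map a) (W2.map a) ∘ₗ
        (TensorProduct.congr (e.app _) (f.app _)).toLinearMap)
      (TensorProduct.ext' fun p q => ?_) v
    simp [e.comm, f.comm]

/-- Isomorphism classes form a commutative monoid under the tensor product. -/
noncomputable instance : CommMonoid (IsoClass K Q) where
  mul := Quotient.map₂ Rep.tensor fun _ _ ⟨e⟩ _ _ ⟨f⟩ => ⟨e.tensor f⟩
  one := (Rep.one K Q).cls
  mul_assoc := by
    rintro ⟨U⟩ ⟨V⟩ ⟨W⟩
    refine Quotient.sound ⟨⟨fun x => TensorProduct.assoc K _ _ _, ?_⟩⟩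
    intro a v
    exact LinearMap.congr_fun (f := (TensorProduct.assoc K _ _ _).toLinearMap ∘ₗ
      TensorProduct.map (TensorProduct.map (U.map a) (V.map a)) (W.map a))
      (g := TensorProduct.map (U.map a) (TensorProduct.map (V.map a) (W.map a)) ∘ₗ
        (TensorProduct.assoc K _ _ _).toLinearMap)
      (TensorProduct.ext_threefold fun _ _ _ => rfl) v
  mul_comm := by
    rintro ⟨U⟩ ⟨V⟩
    refine Quotient.sound ⟨⟨fun x => TensorProduct.comm K _ _, ?_⟩⟩
    intro a v
    exact LinearMap.congr_fun (f := (TensorProduct.comm K _ _).toLinearMap ∘ₗ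
      TensorProduct.map (U.map a) (V.map a))
      (g := TensorProduct.map (V.map a) (U.map a) ∘ₗ (TensorProduct.comm K _ _).toLinearMap)
      (TensorProduct.ext' fun _ _ => rfl) v
  one_mul := by
    rintro ⟨V⟩
    refine Quotient.sound ⟨⟨fun x => TensorProduct.lid K _, ?_⟩⟩
    intro a v
    exact LinearMap.congr_fun (f := (TensorProduct.lid K _).toLinearMap ∘ₗ
      TensorProduct.map (LinearMap.id (M := K)) (V.map a))
      (g := V.map a ∘ₗ (TensorProduct.lid K _).toLinearMap)
      (TensorProduct.ext' fun p q => by simp) v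
  mul_one := by
    rintro ⟨V⟩
    refine Quotient.sound ⟨⟨fun x => TensorProduct.rid K _, ?_⟩⟩
    intro a v
    exact LinearMap.congr_fun (f := (TensorProduct.rid K _).toLinearMap ∘ₗ
      TensorProduct.map (V.map a) (LinearMap.id (M := K)))
      (g := V.map a ∘ₗ (TensorProduct.rid K _).toLinearMap)
      (TensorProduct.ext' fun p q => by simp) v

variable (K Q)

/-- The elements `[V ⊕ W] - [V] - [W]` of the free abelian group on isomorphism classes. -/
def relations : Set (FreeAbelianGroup (IsoClass K Q)) :=
  {r | ∃ V W : Rep K Q, r = FreeAbelianGroup.of (V.dsum W).cls - FreeAbelianGroup.of V.cls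
    - FreeAbelianGroup.of W.cls}

variable {K Q}

theorem tensor_dsum_cls (U V W : Rep K Q) :
    U.cls * (V.dsum W).cls = ((U.tensor V).dsum (U.tensor W)).cls := by
  refine Quotient.sound ⟨⟨fun x => TensorProduct.prodRight K K _ _ _, ?_⟩⟩
  intro a v
  refine LinearMap.congr_fun (f := (TensorProduct.prodRight K K _ _ _).toLinearMap ∘ₗ
      TensorProduct.map (U.map a) ((V.map a).prodMap (W.map a)))
      (g := ((TensorProduct.map (U.map a) (V.map a)).prodMap
        (TensorProduct.map (U.map a) (W.map a))) ∘ₗ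
        (TensorProduct.prodRight K K _ _ _).toLinearMap)
      (TensorProduct.ext' fun p q => ?_) v
  simp

theorem mul_mem_relations (c r : FreeAbelianGroup (IsoClass K Q))
    (hr : r ∈ AddSubgroup.closure (relations K Q)) :
    c * r ∈ AddSubgroup.closure (relations K Q) := by
  induction c using FreeAbelianGroup.induction_on with
  | zero => simp
  | of c =>
    induction hr using AddSubgroup.closure_induction with
    | mem r hr =>
      obtain ⟨V, W, rfl⟩ := hr
      obtain ⟨U⟩ := c
      refine AddSubgroup.subset_closure ⟨U.tensor V, U.tensor W, ?_⟩
      change FreeAbelianGroup.of U.cls * _ = _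
      rw [← tensor_dsum_cls, mul_sub, mul_sub, FreeAbelianGroup.of_mul_of,
        FreeAbelianGroup.of_mul_of, FreeAbelianGroup.of_mul_of]
      rfl
    | zero => simp
    | add x y _ _ hx hy => rw [mul_add]; exact add_mem hx hy
    | neg x _ hx => rw [mul_neg]; exact neg_mem hx
  | neg c h => rw [neg_mul]; exact neg_mem h
  | add c d hc hd => rw [add_mul]; exact add_mem hc hd

variable (K Q)

/-- The subgroup generated by the relations `[V ⊕ W] - [V] - [W]`; it is an ideal. -/
noncomputable def relIdeal : Ideal (FreeAbelianGroup (IsoClass K Q)) where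
  toAddSubmonoid := (AddSubgroup.closure (relations K Q)).toAddSubmonoid
  smul_mem' c r hr := mul_mem_relations c r hr

/-- The representation ring `R(Q)`: the free abelian group on isomorphism classes of
representations, with product induced by the tensor product, modulo the subgroup generated by
all `[V ⊕ W] - [V] - [W]`. -/
abbrev RepRing : Type (u + 1) := FreeAbelianGroup (IsoClass K Q) ⧸ relIdeal K Q

variable {K Q}

/-- The class of a representation in the representation ring. -/
noncomputable def Rep.toRing (V : Rep K Q) : RepRing K Q :=
  Ideal.Quotient.mk (relIdeal K Q) (FreeAbelianGroup.of V.cls)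

end RepRing

/-! ## Acyclic categories and Möbius functions -/

section Mobius

universe v w

/-- The only endomorphisms are identities, and only identities are invertible. -/
structure IsAcyclicCategory (C : Type w) [Category.{v} C] : Prop where
  endo : ∀ (x : C) (f : x ⟶ x), f = 𝟙 x
  iso : ∀ (x y : C) (f : x ⟶ y), IsIso f → ∃ h : x = y, f = eqToHom h

/-- The Hom matrix: the entry at `(x, y)` is the number of morphisms from `x` to `y`. -/
noncomputable def homMatrix (C : Type w) [Category.{v} C] : Matrix C C ℤ :=
  fun x y => (Nat.card (x ⟶ y) : ℤ)

open Classical in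
/-- The Möbius function of a finite acyclic category: the inverse of the Hom matrix. -/
noncomputable def mobius (C : Type w) [Category.{v} C] [Finite C] : Matrix C C ℤ :=
  letI := Fintype.ofFinite C
  (homMatrix C)⁻¹

/-- The element `δ_x = ∑ z, μ(z, x) z` of the free abelian group on the objects. -/
noncomputable def delta {C : Type w} [Category.{v} C] [Finite C] (x : C) : C →₀ ℤ :=
  Finsupp.equivFunOnFinite.symm fun z => mobius C z x

end Mobius

/-- The hypotheses on a full subcategory `F : C ⥤ OverQ Q` of quivers over `Q`:
it is acyclic, its objects are connected and wrappings, it is closed under fiber products (the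
fiber product of two objects is a disjoint union of objects), and its objects have indecomposable
and pairwise non-isomorphic linearizations. -/
structure MainHypotheses (K : Type u) [Field K] {Q : FinQuiver.{u}} {C : Type (u + 1)}
    [Category.{u} C] (F : C ⥤ OverQ Q) : Prop where
  full : F.Full
  faithful : F.Faithful
  acyclic : IsAcyclicCategory C
  connected : ∀ x, (F.obj x).quiv.IsConnected
  wrapping : ∀ x, (F.obj x).IsWrapping
  fiberProd : ∀ x y, ∃ (n : ℕ) (w : Fin n → C),
    Nonempty ((F.obj x).fiberProd (F.obj y) ≅ OverQ.disjointUnion fun k => F.obj (w k))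
  indecomposable : ∀ x, (linearization K (F.obj x)).IsIndecomposable
  distinct : ∀ x y, x ≠ y →
    ¬ Nonempty (Rep.Iso (linearization K (F.obj x)) (linearization K (F.obj y)))

/-- The linearization map `L`, extended by linearity to the free abelian group on the objects
of the PIE category. -/
noncomputable def linMap (K : Type u) [Field K] (Q : FinQuiver.{u}) [Q.IsAcyclic] :
    (PIE Q →₀ ℤ) →ₗ[ℤ] RepRing K Q :=
  Finsupp.linearCombination ℤ fun x => (linearization K ((PIE.incl Q).obj x)).toRing

/-- The idempotent `e_x = L(δ_x)`. -/
noncomputable def pieIdem (K : Type u) [Field K] {Q : FinQuiver.{u}} [Q.IsAcyclic] (x : PIE Q) :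
    RepRing K Q :=
  linMap K Q (delta x)

end QuiverRep

/-!
The quivers `P_T`, `I_T` and `E_T` are characterized up to isomorphism over `Q` by local
properties: `P_T` is a tree growing out of a root in which every arrow of the image lifts, uniquely,
at every vertex over its source; `I_T` is the dual of such a tree; `E_T` is connected and embedded.
A summand of a fiber product inherits enough of these properties to be of one of the three types
again, so every fiber product of objects is a disjoint union of objects.

An endomorphism of the linearization of an object is a scalar: it is determined by its value at
the root, or it is constant along arrows. So the linearization is indecomposable.

Linearization turns disjoint unions, fiber products and the terminal object into sums, products and
`1`. So does the map sending a quiver `X` over `Q` to its marks, the numbers of morphisms to `X`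
from the objects of the PIE category. The Hom matrix of that category is unitriangular, hence marks
identify the free abelian group on the objects with a power of `ℤ`. Consequently linearization
defines a ring homomorphism from this power of `ℤ` to the representation ring, and the standard
idempotents, whose preimages under the marks are the `δ_x`, are mapped to the `e_x`.
-/

namespace QuiverRep

namespace FinQuiver

/-- The relation that some arrow goes from `x` to `y`. -/
def Adj (Q : FinQuiver.{u}) (x y : Q.V) : Prop := ∃ a, Q.s a = x ∧ Q.t a = y

/-- A root of a quiver: a vertex from which every vertex is reachable along a directed path. -/
def IsRoot (Q : FinQuiver.{u}) (r : Q.V) : Prop := ∀ y, Relation.ReflTransGen Q.Adj r y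

section

variable {Q R : FinQuiver.{u}} {r : Q.V}

theorem adj_s_t (a : Q.A) : Q.Adj (Q.s a) (Q.t a) := ⟨a, rfl, rfl⟩

theorem IsPath.map (f : Hom Q R) {x y : Q.V} {l : List Q.A} (h : Q.IsPath x l y) :
    R.IsPath (f.onV x) (l.map f.onA) (f.onV y) := by
  induction h with
  | nil => exact .nil
  | snoc a _ ih =>
    rw [List.map_append, ← f.t_onA]
    exact .snoc (f.onA a) ((f.s_onA a).symm ▸ ih)

theorem Hom.isAcyclic [hR : R.IsAcyclic] (f : Hom Q R) : Q.IsAcyclic where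
  eq_nil _ _ h := List.map_eq_nil_iff.1 (hR.eq_nil _ _ (h.map f))

theorem Hom.reflTransGen_adj (f : Hom Q R) {x y : Q.V} (h : Relation.ReflTransGen Q.Adj x y) :
    Relation.ReflTransGen R.Adj (f.onV x) (f.onV y) := by
  refine h.lift f.onV ?_
  rintro _ _ ⟨a, rfl, rfl⟩
  exact ⟨f.onA a, f.s_onA a, f.t_onA a⟩

theorem exists_isPath_of_transGen {x y : Q.V} (h : Relation.TransGen Q.Adj x y) :
    ∃ l, l ≠ [] ∧ Q.IsPath x l y := by
  induction h with
  | single h =>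
    obtain ⟨a, rfl, rfl⟩ := h
    exact ⟨[a], List.cons_ne_nil _ _, .snoc (l := []) a .nil⟩
  | tail _ h ih =>
    obtain ⟨a, rfl, rfl⟩ := h
    obtain ⟨l, -, hl⟩ := ih
    exact ⟨l ++ [a], List.append_ne_nil_of_right_ne_nil _ (List.cons_ne_nil _ _), hl.snoc a⟩

theorem not_transGen_adj_self [hQ : Q.IsAcyclic] (x : Q.V) : ¬ Relation.TransGen Q.Adj x x := by
  intro h
  obtain ⟨l, hl, hpath⟩ := exists_isPath_of_transGen h
  exact hl (hQ.eq_nil _ _ hpath)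

theorem wellFounded_adj (Q : FinQuiver.{u}) [Q.IsAcyclic] : WellFounded Q.Adj :=
  have : Std.Irrefl (Relation.TransGen Q.Adj) := ⟨not_transGen_adj_self⟩
  Subrelation.wf .single (Finite.wellFounded_of_trans_of_irrefl (Relation.TransGen Q.Adj))

theorem eqvGen_adj_op {x y : Q.V} (h : Relation.EqvGen Q.Adj x y) :
    Relation.EqvGen Q.op.Adj x y := by
  induction h with
  | rel _ _ h => exact .symm _ _ (.rel _ _ (h.imp fun _ => And.symm))
  | refl => exact .refl _
  | symm _ _ _ ih => exact .symm _ _ ih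
  | trans _ _ _ _ _ ih ih' => exact .trans _ _ _ ih ih'

theorem IsConnected.op (hQ : Q.IsConnected) : Q.op.IsConnected :=
  ⟨hQ.1, fun v w => eqvGen_adj_op (hQ.2 v w)⟩

theorem IsConnected.induction (hQ : Q.IsConnected) {P : Q.V → Prop} (hr : P r)
    (h : ∀ a, P (Q.s a) ↔ P (Q.t a)) (y : Q.V) : P y := by
  have iff_of_eqvGen : ∀ x y, Relation.EqvGen Q.Adj x y → (P x ↔ P y) := by
    intro x y hxy
    induction hxy with
    | rel _ _ h' => obtain ⟨a, rfl, rfl⟩ := h'; exact h a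
    | refl => rfl
    | symm _ _ _ ih => exact ih.symm
    | trans _ _ _ _ _ ih ih' => exact ih.trans ih'
  exact (iff_of_eqvGen r y (hQ.2 r y)).1 hr

theorem Hom.isConnected_of_surjective (f : Hom Q R) (hf : Function.Surjective f.onV)
    (hQ : Q.IsConnected) : R.IsConnected := by
  refine ⟨hQ.1.map f.onV, hf.forall₂.2 fun x y => ?_⟩
  exact hQ.induction (P := fun y => Relation.EqvGen R.Adj (f.onV x) (f.onV y)) (.refl _)
    (fun a => by
      have edge : Relation.EqvGen R.Adj (f.onV (Q.s a)) (f.onV (Q.t a)) :=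
        .rel _ _ ⟨f.onA a, f.s_onA a, f.t_onA a⟩
      exact ⟨fun h => .trans _ _ _ h edge, fun h => .trans _ _ _ h (.symm _ _ edge)⟩) y

theorem IsRoot.induction (hr : Q.IsRoot r) {P : Q.V → Prop} (h0 : P r)
    (h : ∀ a, P (Q.s a) → P (Q.t a)) (y : Q.V) : P y := by
  induction hr y with
  | refl => exact h0
  | tail _ hadj ih => obtain ⟨a, rfl, rfl⟩ := hadj; exact h a ih

theorem IsRoot.isConnected (hr : Q.IsRoot r) : Q.IsConnected :=
  have eqvGen (y : Q.V) : Relation.EqvGen Q.Adj r y :=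
    hr.induction (.refl _) (fun a h => .trans _ _ _ h (.rel _ _ (adj_s_t a))) y
  ⟨⟨r⟩, fun v w => .trans _ _ _ (.symm _ _ (eqvGen v)) (eqvGen w)⟩

theorem IsRoot.t_ne [Q.IsAcyclic] (hr : Q.IsRoot r) (a : Q.A) : Q.t a ≠ r := fun h =>
  not_transGen_adj_self r (.tail' (hr (Q.s a)) (h ▸ adj_s_t a))

theorem IsRoot.exists_t_eq (hr : Q.IsRoot r) {y : Q.V} (hy : y ≠ r) : ∃ a, Q.t a = y := by
  obtain rfl | ⟨_, -, a, -, ha⟩ := (hr y).cases_tail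
  · exact (hy rfl).elim
  · exact ⟨a, ha⟩

theorem Hom.eq_of_reflTransGen [R.IsAcyclic] (f : Hom Q R) {x y : Q.V}
    (h : Relation.ReflTransGen Q.Adj x y) (hxy : f.onV x = f.onV y) : x = y := by
  obtain rfl | ⟨z, hz, a, rfl, rfl⟩ := h.cases_tail
  · rfl
  · refine (not_transGen_adj_self (f.onV x) (.tail' (f.reflTransGen_adj hz) ?_)).elim
    exact ⟨f.onA a, f.s_onA a, (f.t_onA a).trans hxy.symm⟩

theorem IsRoot.eq_of_onV_eq [R.IsAcyclic] (hr : Q.IsRoot r) (f : Hom Q R) {y : Q.V}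
    (hy : f.onV y = f.onV r) : y = r :=
  (f.eq_of_reflTransGen (hr y) hy.symm).symm

theorem exists_isRoot [Q.IsAcyclic] (hQ : Q.IsConnected) (ht : Function.Injective Q.t) :
    ∃ r, Q.IsRoot r := by
  obtain ⟨r, -, hr⟩ := Q.wellFounded_adj.has_min Set.univ ⟨hQ.1.some, trivial⟩
  refine ⟨r, fun y => hQ.induction (P := Relation.ReflTransGen Q.Adj r) .refl
    (fun a => ⟨fun h => h.tail (adj_s_t a), fun h => ?_⟩) y⟩
  obtain h | ⟨_, h, b, rfl, hb⟩ := h.cases_tail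
  · exact (hr _ trivial (h ▸ adj_s_t a)).elim
  · rwa [ht hb.symm]

theorem IsRoot.exists_rec [Q.IsAcyclic] (hr : Q.IsRoot r) (ht : Function.Injective Q.t)
    {N : Q.V → Type*} (w : N r) (step : ∀ a, N (Q.s a) → N (Q.t a)) :
    ∃ c : ∀ y, N y, c r = w ∧ ∀ a, c (Q.t a) = step a (c (Q.s a)) := by
  classical
  let F (y : Q.V) (ih : ∀ x, Q.Adj x y → N x) : N y :=
    if h : y = r then h.symm ▸ w else
      (hr.exists_t_eq h).choose_spec ▸ step (hr.exists_t_eq h).choose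
        (ih _ ⟨_, rfl, (hr.exists_t_eq h).choose_spec⟩)
  refine ⟨Q.wellFounded_adj.fix F, ?_, fun a => ?_⟩
  · rw [WellFounded.fix_eq]
    exact dif_pos rfl
  · rw [WellFounded.fix_eq]
    refine (dif_neg (hr.t_ne a)).trans ?_
    have step_transport (b : Q.A) (hb : Q.t b = Q.t a) :
        (hb ▸ step b (Q.wellFounded_adj.fix F (Q.s b)) : N (Q.t a)) =
          step a (Q.wellFounded_adj.fix F (Q.s a)) := by
      obtain rfl := ht hb
      rfl
    exact step_transport _ _

end

end FinQuiver

namespace OverQ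

variable {Q : FinQuiver.{u}} {X Y Z : OverQ Q}

/-! ### Morphisms over `Q` -/

instance (X : OverQ Q) [Q.IsAcyclic] : X.quiv.IsAcyclic := X.str.isAcyclic

@[ext]
theorem hom_ext {f g : X ⟶ Y} (hV : ∀ v, f.hom.onV v = g.hom.onV v)
    (hA : ∀ a, f.hom.onA a = g.hom.onA a) : f = g :=
  Hom.ext (FinQuiver.Hom.ext (funext hV) (funext hA))

@[simp] theorem id_onV (v : X.quiv.V) : (𝟙 X : X ⟶ X).hom.onV v = v := rfl

@[simp] theorem comp_onV (f : X ⟶ Y) (g : Y ⟶ Z) (v : X.quiv.V) :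
    (f ≫ g).hom.onV v = g.hom.onV (f.hom.onV v) := rfl

@[simp] theorem comp_onA (f : X ⟶ Y) (g : Y ⟶ Z) (a : X.quiv.A) :
    (f ≫ g).hom.onA a = g.hom.onA (f.hom.onA a) := rfl

@[simp] theorem str_onV_hom (f : X ⟶ Y) (v : X.quiv.V) :
    Y.str.onV (f.hom.onV v) = X.str.onV v := by
  rw [← f.comm]; rfl

@[simp] theorem str_onA_hom (f : X ⟶ Y) (a : X.quiv.A) :
    Y.str.onA (f.hom.onA a) = X.str.onA a := by
  rw [← f.comm]; rfl

/-- The morphism over `Q` given by a morphism of quivers that commutes with the structure maps. -/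
def homMk (f : FinQuiver.Hom X.quiv Y.quiv) (hV : ∀ v, Y.str.onV (f.onV v) = X.str.onV v)
    (hA : ∀ a, Y.str.onA (f.onA a) = X.str.onA a) : X ⟶ Y :=
  ⟨f, FinQuiver.Hom.ext (funext hV) (funext hA)⟩

instance (X Y : OverQ Q) : Finite (X ⟶ Y) :=
  Finite.of_injective (β := (X.quiv.V → Y.quiv.V) × (X.quiv.A → Y.quiv.A))
    (fun f => (f.hom.onV, f.hom.onA)) fun _ _ h =>
      hom_ext (congrFun (congrArg Prod.fst h)) (congrFun (congrArg Prod.snd h))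

theorem nonempty_iso_of_bijective (f : X ⟶ Y) (hV : Function.Bijective f.hom.onV)
    (hA : Function.Bijective f.hom.onA) : Nonempty (X ≅ Y) := by
  obtain ⟨v, hv, hv'⟩ := Function.bijective_iff_has_inverse.1 hV
  obtain ⟨a, ha, ha'⟩ := Function.bijective_iff_has_inverse.1 hA
  let g : FinQuiver.Hom Y.quiv X.quiv :=
    { onV := v
      onA := a
      s_onA := fun b => hV.1 (by rw [← f.hom.s_onA, ha', hv'])
      t_onA := fun b => hV.1 (by rw [← f.hom.t_onA, ha', hv']) }
  exact ⟨⟨f, homMk g (fun x => by rw [← str_onV_hom f, hv' x])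
    (fun b => by rw [← str_onA_hom f, ha' b]), hom_ext hv ha, hom_ext hv' ha'⟩⟩

/-- The quiver over the opposite of `Q` obtained by reversing all arrows. -/
def op (X : OverQ Q) : OverQ Q.op := OverQ.unop (Q := Q.op) X

/-- Reversing all arrows, as a functor. -/
def opFunctor (Q : FinQuiver.{u}) : OverQ Q ⥤ OverQ Q.op where
  obj := op
  map f := homMk (X := op _) (Y := op _) ⟨f.hom.onV, f.hom.onA, f.hom.t_onA, f.hom.s_onA⟩
    (str_onV_hom f) (str_onA_hom f)

theorem nonempty_iso_of_op (h : Nonempty (X.op ≅ Y.op)) : Nonempty (X ≅ Y) :=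
  h.map (opFunctor Q.op).mapIso

/-! ### Lifting properties -/

/-- Distinct arrows of `X` with a common source lie over distinct arrows of `Q`. The dual condition
on arrows with a common target is `X.op.OutInj`. -/
def OutInj (X : OverQ Q) : Prop :=
  ∀ ⦃a b⦄, X.quiv.s a = X.quiv.s b → X.str.onA a = X.str.onA b → a = b

/-- Each arrow in `S` lifts to `X`, with any prescribed lift of its source. -/
def OutLifts (X : OverQ Q) (S : Set Q.A) : Prop :=
  ∀ v, ∀ α ∈ S, Q.s α = X.str.onV v → ∃ a, X.quiv.s a = v ∧ X.str.onA a = α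

/-- The image of the structure map. -/
def image (X : OverQ Q) : Subquiver Q where
  verts := Set.range X.str.onV
  arrows := Set.range X.str.onA
  s_mem := by rintro _ ⟨a, rfl⟩; exact ⟨_, (X.str.s_onA a).symm⟩
  t_mem := by rintro _ ⟨a, rfl⟩; exact ⟨_, (X.str.t_onA a).symm⟩

/-- The intrinsic description of the quivers `P_T`: rooted trees in which every arrow below the
tree lifts uniquely from any lift of its source. -/
structure IsOutTree (X : OverQ Q) : Prop where
  connected : X.quiv.IsConnected
  t_injective : Function.Injective X.quiv.t
  outInj : X.OutInj
  outLifts : X.OutLifts X.image.arrows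

/-- The intrinsic description of the quivers `I_T`, dual to that of `P_T`. -/
def IsInTree (X : OverQ Q) : Prop := X.op.IsOutTree

/-- The intrinsic description of the quivers `E_T`: connected quivers embedded in `Q`. -/
structure IsConnectedEmbedding (X : OverQ Q) : Prop where
  connected : X.quiv.IsConnected
  onV_injective : Function.Injective X.str.onV
  onA_injective : Function.Injective X.str.onA

/-- Quivers over `Q` of one of the three types `P_T`, `I_T`, `E_T`. -/
def IsPIEType (X : OverQ Q) : Prop := X.IsOutTree ∨ X.IsInTree ∨ X.IsConnectedEmbedding

theorem OutInj.of_s_injective (h : Function.Injective X.quiv.s) : X.OutInj :=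
  fun _ _ hab _ => h hab

theorem OutInj.of_onA_injective (h : Function.Injective X.str.onA) : X.OutInj :=
  fun _ _ _ hab => h hab

theorem OutInj.isWrapping (h : X.OutInj) : X.IsWrapping := fun _ _ hs _ hA => h hs hA

theorem OutInj.onA_injective (h : X.OutInj) (hV : Function.Injective X.str.onV) :
    Function.Injective X.str.onA := fun a b hab =>
  h (hV (by rw [← X.str.s_onA, hab, X.str.s_onA])) hab

theorem OutLifts.mono {S S' : Set Q.A} (h : X.OutLifts S') (hS : S ⊆ S') : X.OutLifts S :=
  fun v α hα => h v α (hS hα)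

theorem IsConnectedEmbedding.op (h : X.IsConnectedEmbedding) : X.op.IsConnectedEmbedding :=
  ⟨h.connected.op, h.onV_injective, h.onA_injective⟩

theorem IsConnectedEmbedding.outLifts (h : X.IsConnectedEmbedding) :
    X.OutLifts X.image.arrows := by
  rintro v _ ⟨b, rfl⟩ hv
  exact ⟨b, h.onV_injective (by rw [← hv, X.str.s_onA]), rfl⟩

theorem IsPIEType.op (h : X.IsPIEType) : X.op.IsPIEType :=
  h.elim (fun h => .inr (.inl h)) fun h => h.elim .inl fun h => .inr (.inr h.op)

theorem IsPIEType.connected (h : X.IsPIEType) : X.quiv.IsConnected :=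
  h.elim (·.connected) fun h => h.elim (·.connected.op) (·.connected)

theorem IsPIEType.outInj (h : X.IsPIEType) : X.OutInj :=
  h.elim (·.outInj) fun h => h.elim (fun h => .of_s_injective h.t_injective)
    fun h => .of_onA_injective h.onA_injective

theorem IsPIEType.isConnectedEmbedding (h : X.IsPIEType) (hV : Function.Injective X.str.onV) :
    X.IsConnectedEmbedding :=
  ⟨h.connected, hV, h.outInj.onA_injective hV⟩

/-! ### Morphisms out of trees -/

theorem exists_hom_of_isRoot [Q.IsAcyclic] {r : X.quiv.V} (hr : X.quiv.IsRoot r)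
    (ht : Function.Injective X.quiv.t) (hY : Y.OutLifts X.image.arrows) {y : Y.quiv.V}
    (hy : Y.str.onV y = X.str.onV r) : ∃ f : X ⟶ Y, f.hom.onV r = y := by
  have exists_lift (a : X.quiv.A) (z : {z // Y.str.onV z = X.str.onV (X.quiv.s a)}) :
      ∃ b, Y.quiv.s b = z ∧ Y.str.onA b = X.str.onA a :=
    hY z _ ⟨a, rfl⟩ (by rw [z.2, X.str.s_onA])
  choose lift s_lift onA_lift using exists_lift
  obtain ⟨c, c_root, c_t⟩ := hr.exists_rec ht
    (N := fun v => {z // Y.str.onV z = X.str.onV v}) ⟨y, hy⟩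
    fun a z => ⟨Y.quiv.t (lift a z), by rw [← Y.str.t_onA, onA_lift, X.str.t_onA]⟩
  let f : FinQuiver.Hom X.quiv Y.quiv :=
    { onV := fun v => (c v).1
      onA := fun a => lift a (c (X.quiv.s a))
      s_onA := fun a => s_lift a _
      t_onA := fun a => by rw [c_t] }
  exact ⟨homMk f (fun v => (c v).2) (fun a => onA_lift a _), congrArg Subtype.val c_root⟩

theorem OutInj.hom_ext_of_isRoot (hY : Y.OutInj) {r : X.quiv.V} (hr : X.quiv.IsRoot r)
    {f g : X ⟶ Y} (h : f.hom.onV r = g.hom.onV r) : f = g := by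
  have onA_eq (a : X.quiv.A) (ha : f.hom.onV (X.quiv.s a) = g.hom.onV (X.quiv.s a)) :
      f.hom.onA a = g.hom.onA a :=
    hY (by rw [f.hom.s_onA, ha, g.hom.s_onA]) (by rw [str_onA_hom, str_onA_hom])
  have onV_eq (v : X.quiv.V) : f.hom.onV v = g.hom.onV v :=
    hr.induction (P := fun v => f.hom.onV v = g.hom.onV v) h
      (fun a ha => by rw [← f.hom.t_onA, onA_eq a ha, g.hom.t_onA]) v
  exact hom_ext onV_eq fun a => onA_eq a (onV_eq _)

theorem nonempty_iso_of_isRoot [Q.IsAcyclic] {r : X.quiv.V} {r' : Y.quiv.V}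
    (hr : X.quiv.IsRoot r) (hr' : Y.quiv.IsRoot r') (hXt : Function.Injective X.quiv.t)
    (hYt : Function.Injective Y.quiv.t) (hX : X.OutInj) (hY : Y.OutInj)
    (hXY : X.OutLifts Y.image.arrows) (hYX : Y.OutLifts X.image.arrows)
    (h : X.str.onV r = Y.str.onV r') : Nonempty (X ≅ Y) := by
  obtain ⟨f, hf⟩ := exists_hom_of_isRoot hr hXt hYX h.symm
  obtain ⟨g, hg⟩ := exists_hom_of_isRoot hr' hYt hXY h
  exact ⟨⟨f, g, hX.hom_ext_of_isRoot hr (by simp [hf, hg]),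
    hY.hom_ext_of_isRoot hr' (by simp [hf, hg])⟩⟩

theorem IsOutTree.exists_isRoot [Q.IsAcyclic] (hX : X.IsOutTree) : ∃ r, X.quiv.IsRoot r :=
  FinQuiver.exists_isRoot hX.connected hX.t_injective

theorem IsOutTree.eq_id [Q.IsAcyclic] (hX : X.IsOutTree) (f : X ⟶ X) : f = 𝟙 X := by
  obtain ⟨r, hr⟩ := hX.exists_isRoot
  exact hX.outInj.hom_ext_of_isRoot hr (hr.eq_of_onV_eq X.str (str_onV_hom f r))

theorem IsPIEType.eq_id [Q.IsAcyclic] (hX : X.IsPIEType) (f : X ⟶ X) : f = 𝟙 X := by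
  obtain h | h | h := hX
  · exact h.eq_id f
  · have op_eq : (opFunctor Q).map f = 𝟙 X.op := h.eq_id _
    exact hom_ext (fun v => congrArg (fun g : X.op ⟶ X.op => g.hom.onV v) op_eq)
      fun a => congrArg (fun g : X.op ⟶ X.op => g.hom.onA a) op_eq
  · exact hom_ext (fun v => h.onV_injective (str_onV_hom f v))
      fun a => h.onA_injective (str_onA_hom f a)

end OverQ

/-- The opposite of a subquiver. -/
def Subquiver.op {Q : FinQuiver.{u}} (T : Subquiver Q) : Subquiver Q.op :=
  ⟨T.verts, T.arrows, T.t_mem, T.s_mem⟩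

namespace OverQ

variable {Q : FinQuiver.{u}}

/-! ### The three types of objects -/

section

variable [Q.IsAcyclic]

theorem isRoot_objP (T : Subquiver Q) (i : T.toFinQuiver.V) :
    (objP T i).quiv.IsRoot
      (⟨([], i), .nil⟩ : {p : List _ × _ // T.toFinQuiver.IsPath i p.1 p.2}) := by
  rintro ⟨⟨l, v⟩, hl⟩
  change T.toFinQuiver.IsPath i l v at hl
  induction hl with
  | nil => exact .refl
  | snoc a h ih => exact ih.tail ⟨⟨(⟨(_, _), h⟩, a), rfl⟩, rfl, rfl⟩

theorem t_injective_objP (T : Subquiver Q) (i : T.toFinQuiver.V) :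
    Function.Injective (objP T i).quiv.t := by
  rintro ⟨⟨⟨⟨l, v⟩, hl⟩, a⟩, (rfl : v = T.toFinQuiver.s a)⟩
    ⟨⟨⟨⟨m, w⟩, hm⟩, b⟩, (rfl : w = T.toFinQuiver.s b)⟩ h
  have snoc_eq : l ++ [a] = m ++ [b] := congrArg (fun p => p.1.1) h
  obtain ⟨rfl, hab⟩ := List.append_inj' snoc_eq rfl
  obtain rfl := List.singleton_injective hab
  rfl

theorem outInj_objP (T : Subquiver Q) (i : T.toFinQuiver.V) : (objP T i).OutInj := by
  rintro ⟨⟨p, a⟩, ha⟩ ⟨⟨q, b⟩, hb⟩ (rfl : p = q) hab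
  obtain rfl : a = b := Subtype.ext hab
  rfl

theorem outLifts_objP (T : Subquiver Q) (i : T.toFinQuiver.V) : (objP T i).OutLifts T.arrows :=
  fun v α hα h => ⟨⟨(v, ⟨α, hα⟩), Subtype.ext h.symm⟩, rfl, rfl⟩

theorem image_objP_arrows_subset (T : Subquiver Q) (i : T.toFinQuiver.V) :
    (objP T i).image.arrows ⊆ T.arrows :=
  Set.range_subset_iff.2 fun a => a.1.2.2

theorem isOutTree_objP (T : Subquiver Q) (i : T.toFinQuiver.V) : (objP T i).IsOutTree :=
  ⟨(isRoot_objP T i).isConnected, t_injective_objP T i, outInj_objP T i,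
    (outLifts_objP T i).mono (image_objP_arrows_subset T i)⟩

theorem isInTree_objI (T : Subquiver Q) (i : T.toFinQuiver.V) : (objI T i).IsInTree :=
  isOutTree_objP T.op i

end

theorem isConnectedEmbedding_objE {T : Subquiver Q} (hT : T.toFinQuiver.IsConnected) :
    (objE T).IsConnectedEmbedding :=
  ⟨hT, Subtype.val_injective, Subtype.val_injective⟩

variable {X Y : OverQ Q}

theorem isUniqueSource_image [Q.IsAcyclic] {r : X.quiv.V} (hr : X.quiv.IsRoot r) :
    X.image.toFinQuiver.IsUniqueSource (⟨X.str.onV r, r, rfl⟩ : X.image.verts) := by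
  rintro ⟨_, v, rfl⟩
  constructor
  · intro hv
    by_contra hne
    obtain ⟨a, rfl⟩ := hr.exists_t_eq (y := v) (by rintro rfl; exact hne rfl)
    exact hv ⟨X.str.onA a, a, rfl⟩ (Subtype.ext (X.str.t_onA a))
  · rintro hv ⟨_, a, rfl⟩ ha
    refine hr.t_ne a (hr.eq_of_onV_eq X.str ?_)
    rw [← X.str.t_onA]
    exact congrArg Subtype.val (ha.trans hv)

theorem IsOutTree.exists_iso_objP [Q.IsAcyclic] (hX : X.IsOutTree) :
    ∃ i, X.image.toFinQuiver.IsUniqueSource i ∧ Nonempty (X ≅ objP X.image i) := by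
  obtain ⟨r, hr⟩ := hX.exists_isRoot
  exact ⟨_, isUniqueSource_image hr, nonempty_iso_of_isRoot hr (isRoot_objP _ _) hX.t_injective
    (t_injective_objP _ _) hX.outInj (outInj_objP _ _)
    (hX.outLifts.mono (image_objP_arrows_subset _ _)) (outLifts_objP _ _) rfl⟩

theorem IsInTree.exists_iso_objI [Q.IsAcyclic] (hX : X.IsInTree) :
    ∃ i, X.image.toFinQuiver.IsUniqueSink i ∧ Nonempty (X ≅ objI X.image i) := by
  obtain ⟨i, hi, e⟩ := IsOutTree.exists_iso_objP hX
  exact ⟨i, hi, nonempty_iso_of_op e⟩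

/-- The surjection of `X` onto its image. -/
def toObjE (X : OverQ Q) : X ⟶ objE X.image :=
  homMk (Y := objE X.image) ⟨fun v => ⟨X.str.onV v, v, rfl⟩, fun a => ⟨X.str.onA a, a, rfl⟩,
    fun a => Subtype.ext (X.str.s_onA a), fun a => Subtype.ext (X.str.t_onA a)⟩
    (fun _ => rfl) fun _ => rfl

theorem isConnected_image (hX : X.quiv.IsConnected) : X.image.toFinQuiver.IsConnected :=
  X.toObjE.hom.isConnected_of_surjective (by rintro ⟨_, v, rfl⟩; exact ⟨v, rfl⟩) hX

theorem IsConnectedEmbedding.nonempty_iso_objE (hX : X.IsConnectedEmbedding) :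
    Nonempty (X ≅ objE X.image) :=
  nonempty_iso_of_bijective X.toObjE
    ⟨fun _ _ h => hX.onV_injective (congrArg Subtype.val h),
      by rintro ⟨_, v, rfl⟩; exact ⟨v, rfl⟩⟩
    ⟨fun _ _ h => hX.onA_injective (congrArg Subtype.val h),
      by rintro ⟨_, a, rfl⟩; exact ⟨a, rfl⟩⟩

theorem isPIEType_of_isPIE [Q.IsAcyclic] (hX : IsPIE Q X) : X.IsPIEType := by
  cases hX with
  | P T i => exact .inl (isOutTree_objP T i)
  | I T i => exact .inr (.inl (isInTree_objI T i))
  | E T hT => exact .inr (.inr (isConnectedEmbedding_objE hT))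

theorem IsPIEType.exists_isPIE [Q.IsAcyclic] (hX : X.IsPIEType) :
    ∃ Y, IsPIE Q Y ∧ Nonempty (X ≅ Y) := by
  obtain h | h | h := hX
  · obtain ⟨i, hi, e⟩ := h.exists_iso_objP
    exact ⟨_, .P _ i hi, e⟩
  · obtain ⟨i, hi, e⟩ := h.exists_iso_objI
    exact ⟨_, .I _ i hi, e⟩
  · exact ⟨_, .E _ (isConnected_image h.connected), h.nonempty_iso_objE⟩

/-! ### Recovering an object from its image -/

theorem IsOutTree.nonempty_iso_of_image_eq [Q.IsAcyclic] (hX : X.IsOutTree) (hY : Y.IsOutTree)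
    (h : X.image = Y.image) : Nonempty (X ≅ Y) := by
  obtain ⟨i, hi, ⟨e⟩⟩ := hX.exists_iso_objP
  obtain ⟨j, hj, ⟨e'⟩⟩ := h ▸ hY.exists_iso_objP
  obtain rfl : i = j := (hj i).1 ((hi i).2 rfl)
  exact ⟨e ≪≫ e'.symm⟩

theorem IsInTree.nonempty_iso_of_image_eq [Q.IsAcyclic] (hX : X.IsInTree) (hY : Y.IsInTree)
    (h : X.image = Y.image) : Nonempty (X ≅ Y) := by
  obtain ⟨i, hi, ⟨e⟩⟩ := hX.exists_iso_objI
  obtain ⟨j, hj, ⟨e'⟩⟩ := h ▸ hY.exists_iso_objI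
  obtain rfl : i = j := (hj i).1 ((hi i).2 rfl)
  exact ⟨e ≪≫ e'.symm⟩

theorem IsConnectedEmbedding.nonempty_iso_of_image_eq (hX : X.IsConnectedEmbedding)
    (hY : Y.IsConnectedEmbedding) (h : X.image = Y.image) : Nonempty (X ≅ Y) := by
  obtain ⟨e⟩ := hX.nonempty_iso_objE
  obtain ⟨e'⟩ := h ▸ hY.nonempty_iso_objE
  exact ⟨e ≪≫ e'.symm⟩

end OverQ

namespace OverQ

variable {Q : FinQuiver.{u}} {X Y Z W : OverQ Q}

/-! ### Components and disjoint unions -/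

/-- `i` identifies its source with a union of connected components of its target. -/
structure IsSummand (i : Z ⟶ X) : Prop where
  onV_injective : Function.Injective i.hom.onV
  onA_injective : Function.Injective i.hom.onA
  exists_of_s : ∀ v a, X.quiv.s a = i.hom.onV v → ∃ b, i.hom.onA b = a
  exists_of_t : ∀ v a, X.quiv.t a = i.hom.onV v → ∃ b, i.hom.onA b = a

namespace IsSummand

variable {i : Z ⟶ X}

theorem op (hi : IsSummand i) : IsSummand ((opFunctor Q).map i) :=
  ⟨hi.onV_injective, hi.onA_injective, hi.exists_of_t, hi.exists_of_s⟩

theorem t_injective (hi : IsSummand i) (h : Function.Injective X.quiv.t) :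
    Function.Injective Z.quiv.t := fun a b hab =>
  hi.onA_injective (h (by rw [i.hom.t_onA, hab, i.hom.t_onA]))

theorem outInj (hi : IsSummand i) (h : X.OutInj) : Z.OutInj := fun a b hs hA =>
  hi.onA_injective (h (by rw [i.hom.s_onA, hs, i.hom.s_onA]) (by simpa using hA))

theorem outLifts (hi : IsSummand i) {S : Set Q.A} (h : X.OutLifts S) : Z.OutLifts S := by
  intro v α hα hv
  obtain ⟨a, ha, rfl⟩ := h (i.hom.onV v) α hα (by rw [hv, str_onV_hom])
  obtain ⟨b, rfl⟩ := hi.exists_of_s v a ha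
  exact ⟨b, hi.onV_injective (by rw [← i.hom.s_onA, ha]), (str_onA_hom i b).symm⟩

theorem comp_iso (hi : IsSummand i) (e : X ≅ Y) : IsSummand (i ≫ e.hom) := by
  have hV (v : X.quiv.V) : e.inv.hom.onV (e.hom.hom.onV v) = v :=
    congrArg (fun f : X ⟶ X => f.hom.onV v) e.hom_inv_id
  have hA (a : X.quiv.A) : e.inv.hom.onA (e.hom.hom.onA a) = a :=
    congrArg (fun f : X ⟶ X => f.hom.onA a) e.hom_inv_id
  have hA' (a : Y.quiv.A) : e.hom.hom.onA (e.inv.hom.onA a) = a :=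
    congrArg (fun f : Y ⟶ Y => f.hom.onA a) e.inv_hom_id
  refine ⟨(Function.LeftInverse.injective hV).comp hi.onV_injective,
    (Function.LeftInverse.injective hA).comp hi.onA_injective, fun v a ha => ?_, fun v a ha => ?_⟩
  · obtain ⟨b, hb⟩ := hi.exists_of_s v (e.inv.hom.onA a) (by rw [e.inv.hom.s_onA, ha]; exact hV _)
    exact ⟨b, by rw [comp_onA, hb, hA']⟩
  · obtain ⟨b, hb⟩ := hi.exists_of_t v (e.inv.hom.onA a) (by rw [e.inv.hom.t_onA, ha]; exact hV _)
    exact ⟨b, by rw [comp_onA, hb, hA']⟩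

theorem exists_comp_eq (hi : IsSummand i) (hW : W.quiv.IsConnected) (f : W ⟶ X) {w : W.quiv.V}
    (hw : f.hom.onV w ∈ Set.range i.hom.onV) : ∃ g : W ⟶ Z, g ≫ i = f := by
  have hV (v : W.quiv.V) : f.hom.onV v ∈ Set.range i.hom.onV := by
    refine hW.induction (P := fun v => f.hom.onV v ∈ Set.range i.hom.onV) hw (fun a => ?_) v
    rw [← f.hom.s_onA, ← f.hom.t_onA]
    constructor
    · rintro ⟨v, hv⟩
      obtain ⟨b, hb⟩ := hi.exists_of_s v _ hv.symm
      exact ⟨Z.quiv.t b, by rw [← hb, i.hom.t_onA]⟩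
    · rintro ⟨v, hv⟩
      obtain ⟨b, hb⟩ := hi.exists_of_t v _ hv.symm
      exact ⟨Z.quiv.s b, by rw [← hb, i.hom.s_onA]⟩
  have hA (a : W.quiv.A) : ∃ b, i.hom.onA b = f.hom.onA a := by
    obtain ⟨v, hv⟩ := hV (W.quiv.s a)
    exact hi.exists_of_s v _ (by rw [f.hom.s_onA, hv])
  choose gV hgV using hV
  choose gA hgA using hA
  let g : FinQuiver.Hom W.quiv Z.quiv :=
    { onV := gV
      onA := gA
      s_onA := fun a => hi.onV_injective (by rw [hgV, ← i.hom.s_onA, hgA, f.hom.s_onA])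
      t_onA := fun a => hi.onV_injective (by rw [hgV, ← i.hom.t_onA, hgA, f.hom.t_onA]) }
  exact ⟨homMk g (fun v => by rw [← str_onV_hom i, hgV, str_onV_hom])
    (fun a => by rw [← str_onA_hom i, hgA, str_onA_hom]), hom_ext hgV hgA⟩

end IsSummand

theorem isSummand_id (X : OverQ Q) : IsSummand (𝟙 X) :=
  ⟨fun _ _ h => h, fun _ _ h => h, fun _ a _ => ⟨a, rfl⟩, fun _ a _ => ⟨a, rfl⟩⟩

theorem isSummand_of_iso (e : X ≅ Y) : IsSummand e.hom := by
  simpa only [Category.id_comp] using (isSummand_id X).comp_iso e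

namespace disjointUnion

variable {n : ℕ} {w : Fin n → OverQ Q}

/-- The inclusion of a summand into a disjoint union. -/
def inj (w : Fin n → OverQ Q) (k : Fin n) : w k ⟶ disjointUnion w :=
  homMk (Y := disjointUnion w) ⟨fun v => ⟨k, v⟩, fun a => ⟨k, a⟩, fun _ => rfl, fun _ => rfl⟩
    (fun _ => rfl) fun _ => rfl

/-- The morphism out of a disjoint union with given restrictions to the summands. -/
def desc (f : ∀ k, w k ⟶ X) : disjointUnion w ⟶ X :=
  homMk (X := disjointUnion w) ⟨fun v => (f v.1).hom.onV v.2, fun a => (f a.1).hom.onA a.2,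
    fun a => (f a.1).hom.s_onA a.2, fun a => (f a.1).hom.t_onA a.2⟩
    (fun v => str_onV_hom (f v.1) v.2) fun a => str_onA_hom (f a.1) a.2

@[simp] theorem inj_desc (f : ∀ k, w k ⟶ X) (k : Fin n) : inj w k ≫ desc f = f k := rfl

@[simp] theorem inj_desc_assoc (f : ∀ k, w k ⟶ X) (k : Fin n) (g : X ⟶ Y) :
    inj w k ≫ desc f ≫ g = f k ≫ g := rfl

theorem hom_ext {f g : disjointUnion w ⟶ X} (h : ∀ k, inj w k ≫ f = inj w k ≫ g) : f = g :=
  OverQ.hom_ext (fun v => congrArg (fun p : w v.1 ⟶ X => p.hom.onV v.2) (h v.1))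
    fun a => congrArg (fun p : w a.1 ⟶ X => p.hom.onA a.2) (h a.1)

/-- Isomorphic summands have isomorphic disjoint unions. -/
def mapIso {w' : Fin n → OverQ Q} (e : ∀ k, w k ≅ w' k) :
    disjointUnion w ≅ disjointUnion w' where
  hom := desc fun k => (e k).hom ≫ inj w' k
  inv := desc fun k => (e k).inv ≫ inj w k
  hom_inv_id := hom_ext fun k => by simp
  inv_hom_id := hom_ext fun k => by simp

theorem isSummand_inj (k : Fin n) : IsSummand (inj w k) := by
  refine ⟨sigma_mk_injective (β := fun l => (w l).quiv.V),
    sigma_mk_injective (β := fun l => (w l).quiv.A), ?_, ?_⟩ <;>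
  · rintro v ⟨l, a⟩ h
    obtain rfl : l = k := congrArg Sigma.fst h
    exact ⟨a, rfl⟩

/-- The inclusion of the union of all summands but the first. -/
def tail (w : Fin (n + 1) → OverQ Q) :
    disjointUnion (fun k : Fin n => w k.succ) ⟶ disjointUnion w :=
  desc fun k => inj w k.succ

theorem isSummand_tail (w : Fin (n + 1) → OverQ Q) : IsSummand (tail w) := by
  refine ⟨?_, ?_, ?_, ?_⟩
  · rintro ⟨k, v⟩ ⟨l, v'⟩ h
    obtain rfl : k = l := Fin.succ_injective _ (congrArg Sigma.fst h)
    exact congrArg (Sigma.mk k) ((isSummand_inj (w := w) k.succ).onV_injective h)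
  · rintro ⟨k, a⟩ ⟨l, a'⟩ h
    obtain rfl : k = l := Fin.succ_injective _ (congrArg Sigma.fst h)
    exact congrArg (Sigma.mk k) ((isSummand_inj (w := w) k.succ).onA_injective h)
  · rintro ⟨k, v⟩ a h
    obtain ⟨b, rfl⟩ := (isSummand_inj (w := w) k.succ).exists_of_s v a h
    exact ⟨⟨k, b⟩, rfl⟩
  · rintro ⟨k, v⟩ a h
    obtain ⟨b, rfl⟩ := (isSummand_inj (w := w) k.succ).exists_of_t v a h
    exact ⟨⟨k, b⟩, rfl⟩

theorem bijective_inj_zero_tail (w : Fin (n + 1) → OverQ Q) :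
    Function.Bijective (Sum.elim (inj w 0).hom.onV (tail w).hom.onV) := by
  refine ⟨(isSummand_inj 0).onV_injective.sumElim (isSummand_tail w).onV_injective
    fun v v' h => Fin.succ_ne_zero v'.1 (congrArg Sigma.fst h).symm, ?_⟩
  rintro ⟨k, v⟩
  cases k using Fin.cases with
  | zero => exact ⟨.inl v, rfl⟩
  | succ k => exact ⟨.inr ⟨k, v⟩, rfl⟩

end disjointUnion

theorem card_hom_disjointUnion (hZ : Z.quiv.IsConnected) {n : ℕ} (w : Fin n → OverQ Q) :
    Nat.card (Z ⟶ disjointUnion w) = ∑ k, Nat.card (Z ⟶ w k) := by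
  obtain ⟨z⟩ := hZ.1
  rw [← Nat.card_sigma]
  refine (Nat.card_congr (Equiv.ofBijective
    (fun f : Σ k, (Z ⟶ w k) => f.2 ≫ disjointUnion.inj w f.1) ⟨?_, fun f => ?_⟩)).symm
  · rintro ⟨k, f⟩ ⟨l, g⟩ h
    have onV_eq (v) := congrArg (fun p : Z ⟶ disjointUnion w => p.hom.onV v) h
    have onA_eq (a) := congrArg (fun p : Z ⟶ disjointUnion w => p.hom.onA a) h
    obtain rfl : k = l := congrArg Sigma.fst (onV_eq z)
    have hk := disjointUnion.isSummand_inj (w := w) k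
    obtain rfl : f = g := hom_ext (fun v => hk.onV_injective (onV_eq v))
      fun a => hk.onA_injective (onA_eq a)
    rfl
  · obtain ⟨g, hg⟩ := (disjointUnion.isSummand_inj (f.hom.onV z).1).exists_comp_eq hZ f ⟨_, rfl⟩
    exact ⟨⟨_, g⟩, hg⟩

/-- The connected components of the underlying graph. -/
def ConnectedComponent (X : OverQ Q) : Type u :=
  Quotient (Relation.EqvGen.setoid X.quiv.Adj)

/-- The connected component of a vertex. -/
def connectedComponent (v : X.quiv.V) : X.ConnectedComponent :=
  Quotient.mk (Relation.EqvGen.setoid X.quiv.Adj) v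

theorem connectedComponent_s (a : X.quiv.A) :
    connectedComponent (X.quiv.s a) = connectedComponent (X.quiv.t a) :=
  Quotient.sound (.rel _ _ (FinQuiver.adj_s_t a))

/-- A connected component, as a quiver over `Q`. -/
def component (X : OverQ Q) (k : X.ConnectedComponent) : OverQ Q where
  quiv :=
    { V := {v : X.quiv.V // connectedComponent v = k}
      A := {a : X.quiv.A // connectedComponent (X.quiv.s a) = k}
      s := fun a => ⟨X.quiv.s a.1, a.2⟩
      t := fun a => ⟨X.quiv.t a.1, (connectedComponent_s a.1).symm.trans a.2⟩
      finV := inferInstance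
      finA := inferInstance }
  str := ⟨fun v => X.str.onV v.1, fun a => X.str.onA a.1, fun a => X.str.s_onA a.1,
    fun a => X.str.t_onA a.1⟩

/-- The inclusion of a connected component. -/
def componentIncl (X : OverQ Q) (k : X.ConnectedComponent) : X.component k ⟶ X :=
  homMk (X := X.component k) ⟨Subtype.val, Subtype.val, fun _ => rfl, fun _ => rfl⟩
    (fun _ => rfl) fun _ => rfl

theorem isSummand_componentIncl (X : OverQ Q) (k : X.ConnectedComponent) :
    IsSummand (X.componentIncl k) := by
  refine ⟨Subtype.val_injective, Subtype.val_injective, ?_, ?_⟩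
  · rintro ⟨v, hv⟩ a (rfl : X.quiv.s a = v)
    exact ⟨⟨a, hv⟩, rfl⟩
  · rintro ⟨v, hv⟩ a (rfl : X.quiv.t a = v)
    exact ⟨⟨a, (connectedComponent_s a).trans hv⟩, rfl⟩

theorem isConnected_component (X : OverQ Q) (k : X.ConnectedComponent) :
    (X.component k).quiv.IsConnected := by
  obtain ⟨r, hr⟩ := Quotient.exists_rep k
  have eqvGen_component : ∀ x y, Relation.EqvGen X.quiv.Adj x y → ∀ hx hy,
      Relation.EqvGen (X.component k).quiv.Adj ⟨x, hx⟩ ⟨y, hy⟩ := by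
    intro x y h
    induction h with
    | rel _ _ h => obtain ⟨a, rfl, rfl⟩ := h; exact fun hx _ => .rel _ _ ⟨⟨a, hx⟩, rfl, rfl⟩
    | refl => exact fun _ _ => .refl _
    | symm _ _ _ ih => exact fun hx hy => .symm _ _ (ih hy hx)
    | trans _ _ _ h _ ih ih' =>
      intro hx hy
      have hz := (Quotient.sound h).symm.trans hx
      exact .trans _ _ _ (ih hx hz) (ih' hz hy)
  refine ⟨⟨⟨r, hr⟩⟩, ?_⟩
  rintro ⟨v, hv⟩ ⟨w, hw⟩
  exact eqvGen_component v w (Quotient.exact (hv.trans hw.symm)) hv hw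

theorem exists_iso_disjointUnion_components (X : OverQ Q) :
    ∃ (n : ℕ) (k : Fin n → X.ConnectedComponent),
      Nonempty (X ≅ disjointUnion fun j => X.component (k j)) := by
  have : Finite X.ConnectedComponent := Quotient.finite _
  obtain ⟨n, ⟨e⟩⟩ := Finite.exists_equiv_fin X.ConnectedComponent
  let f := disjointUnion.desc fun j => X.componentIncl (e.symm j)
  have hV : Function.Bijective f.hom.onV := by
    refine ⟨?_, fun v => ⟨⟨e (connectedComponent v), v, (e.symm_apply_apply _).symm⟩, rfl⟩⟩
    rintro ⟨j, v, hv⟩ ⟨l, _, hv'⟩ rfl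
    obtain rfl : j = l := e.symm.injective (hv.symm.trans hv')
    rfl
  have hA : Function.Bijective f.hom.onA := by
    refine ⟨?_, fun a => ⟨⟨e (connectedComponent (X.quiv.s a)), a, (e.symm_apply_apply _).symm⟩,
      rfl⟩⟩
    rintro ⟨j, a, ha⟩ ⟨l, _, ha'⟩ rfl
    obtain rfl : j = l := e.symm.injective (ha.symm.trans ha')
    rfl
  obtain ⟨g⟩ := nonempty_iso_of_bijective f hV hA
  exact ⟨n, e.symm, ⟨g.symm⟩⟩

/-! ### Fiber products -/

/-- The first projection of a fiber product. -/
def fst (X Y : OverQ Q) : X.fiberProd Y ⟶ X :=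
  homMk (X := X.fiberProd Y) ⟨fun p => p.1.1, fun p => p.1.1, fun _ => rfl, fun _ => rfl⟩
    (fun _ => rfl) fun _ => rfl

/-- The second projection of a fiber product. -/
def snd (X Y : OverQ Q) : X.fiberProd Y ⟶ Y :=
  homMk (X := X.fiberProd Y) ⟨fun p => p.1.2, fun p => p.1.2, fun _ => rfl, fun _ => rfl⟩
    (fun p => p.2.symm) fun p => p.2.symm

theorem fiberProd_ext_V {v w : (X.fiberProd Y).quiv.V}
    (h₁ : (fst X Y).hom.onV v = (fst X Y).hom.onV w)
    (h₂ : (snd X Y).hom.onV v = (snd X Y).hom.onV w) : v = w :=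
  Subtype.ext (Prod.ext h₁ h₂)

theorem fiberProd_ext_A {a b : (X.fiberProd Y).quiv.A}
    (h₁ : (fst X Y).hom.onA a = (fst X Y).hom.onA b)
    (h₂ : (snd X Y).hom.onA a = (snd X Y).hom.onA b) : a = b :=
  Subtype.ext (Prod.ext h₁ h₂)

/-- The universal property of the fiber product. -/
def fiberProdHomEquiv (Z X Y : OverQ Q) : (Z ⟶ X.fiberProd Y) ≃ (Z ⟶ X) × (Z ⟶ Y) where
  toFun f := (f ≫ fst X Y, f ≫ snd X Y)
  invFun f := homMk (Y := X.fiberProd Y)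
    { onV := fun v => ⟨(f.1.hom.onV v, f.2.hom.onV v), by simp⟩
      onA := fun a => ⟨(f.1.hom.onA a, f.2.hom.onA a), by simp⟩
      s_onA := fun a => fiberProd_ext_V (f.1.hom.s_onA a) (f.2.hom.s_onA a)
      t_onA := fun a => fiberProd_ext_V (f.1.hom.t_onA a) (f.2.hom.t_onA a) }
    (str_onV_hom f.1) (str_onA_hom f.1)
  left_inv _ := rfl
  right_inv _ := rfl

/-- The symmetry of the fiber product. -/
def fiberProdComm (X Y : OverQ Q) : X.fiberProd Y ≅ Y.fiberProd X where
  hom := (fiberProdHomEquiv _ _ _).symm (snd X Y, fst X Y)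
  inv := (fiberProdHomEquiv _ _ _).symm (snd Y X, fst Y X)

theorem card_hom_fiberProd (Z X Y : OverQ Q) :
    Nat.card (Z ⟶ X.fiberProd Y) = Nat.card (Z ⟶ X) * Nat.card (Z ⟶ Y) := by
  rw [Nat.card_congr (fiberProdHomEquiv Z X Y), Nat.card_prod]

theorem t_injective_fiberProd (hX : Function.Injective X.quiv.t) (hY : Y.op.OutInj) :
    Function.Injective (X.fiberProd Y).quiv.t := by
  intro p q h
  have fst_eq : p.1.1 = q.1.1 := hX (congrArg (fun v => v.1.1) h)
  refine fiberProd_ext_A fst_eq (hY (congrArg (fun v => v.1.2) h) ?_)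
  exact p.2.symm.trans ((congrArg X.str.onA fst_eq).trans q.2)

theorem OutInj.fiberProd (hX : X.OutInj) (hY : Y.OutInj) : (X.fiberProd Y).OutInj := by
  intro p q hs hA
  exact fiberProd_ext_A (hX (congrArg (fun v => v.1.1) hs) hA)
    (hY (congrArg (fun v => v.1.2) hs) (p.2.symm.trans (hA.trans q.2)))

theorem OutLifts.fiberProd {S : Set Q.A} (hX : X.OutLifts S) (hY : Y.OutLifts S) :
    (X.fiberProd Y).OutLifts S := by
  rintro ⟨⟨v, w⟩, hvw⟩ α hα (hv : Q.s α = X.str.onV v)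
  obtain ⟨a, rfl, ha⟩ := hX v α hα hv
  obtain ⟨b, rfl, hb⟩ := hY w α hα (hv.trans hvw)
  exact ⟨⟨(a, b), ha.trans hb.symm⟩, rfl, ha⟩

theorem image_arrows_subset (f : X ⟶ Y) : X.image.arrows ⊆ Y.image.arrows := by
  rintro _ ⟨a, rfl⟩
  exact ⟨f.hom.onA a, str_onA_hom f a⟩

/-! ### Components of fiber products -/

theorem isConnectedEmbedding_of_s_t_injective [Q.IsAcyclic] (hX : X.quiv.IsConnected)
    (hs : Function.Injective X.quiv.s) (ht : Function.Injective X.quiv.t) :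
    X.IsConnectedEmbedding := by
  obtain ⟨r, hr⟩ := FinQuiver.exists_isRoot hX ht
  have reachable_or (v w : X.quiv.V) : Relation.ReflTransGen X.quiv.Adj w v ∨
      Relation.ReflTransGen X.quiv.Adj v w := by
    refine hr.induction (P := fun v => Relation.ReflTransGen X.quiv.Adj w v ∨
      Relation.ReflTransGen X.quiv.Adj v w) (.inr (hr w)) ?_ v
    rintro a (h | h)
    · exact .inl (h.tail (FinQuiver.adj_s_t a))
    · obtain rfl | ⟨_, ⟨b, hb, rfl⟩, h⟩ := h.cases_head
      · exact .inl (.single (FinQuiver.adj_s_t a))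
      · exact .inr (hs hb ▸ h)
  have hV : Function.Injective X.str.onV := fun v w hvw =>
    (reachable_or v w).elim (fun h => X.str.eq_of_reflTransGen h hvw.symm |>.symm)
      fun h => X.str.eq_of_reflTransGen h hvw
  exact ⟨hX, hV, (OutInj.of_s_injective hs).onA_injective hV⟩

section

variable {i : Z ⟶ X.fiberProd Y}

theorem IsOutTree.of_isSummand_fiberProd (hX : X.IsOutTree) (hY : Y.OutInj) (hY' : Y.op.OutInj)
    (hYl : Y.OutLifts Y.image.arrows) (hZ : Z.quiv.IsConnected) (hi : IsSummand i) :
    Z.IsOutTree where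
  connected := hZ
  t_injective := hi.t_injective (t_injective_fiberProd hX.t_injective hY')
  outInj := hi.outInj (hX.outInj.fiberProd hY)
  outLifts := hi.outLifts ((hX.outLifts.mono (image_arrows_subset (i ≫ fst X Y))).fiberProd
    (hYl.mono (image_arrows_subset (i ≫ snd X Y))))

theorem IsPIEType.of_isSummand_fiberProd_isOutTree [Q.IsAcyclic] (hX : X.IsOutTree)
    (hY : Y.IsPIEType) (hZ : Z.quiv.IsConnected) (hi : IsSummand i) : Z.IsPIEType := by
  have of_outLifts (h : Y.OutLifts Y.image.arrows) : Z.IsPIEType :=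
    .inl (hX.of_isSummand_fiberProd hY.outInj hY.op.outInj h hZ hi)
  obtain h | h | h := id hY
  · exact of_outLifts h.outLifts
  · refine .inr (.inr (isConnectedEmbedding_of_s_t_injective hZ ?_ ?_))
    · exact (hi.comp_iso (fiberProdComm X Y)).op.t_injective
        (t_injective_fiberProd (X := Y.op) (Y := X.op) h.t_injective hX.outInj)
    · exact hi.t_injective (t_injective_fiberProd hX.t_injective hY.op.outInj)
  · exact of_outLifts h.outLifts

theorem IsPIEType.of_isSummand_fiberProd_isInTree [Q.IsAcyclic] (hX : X.IsInTree)
    (hY : Y.IsPIEType) (hZ : Z.quiv.IsConnected) (hi : IsSummand i) : Z.IsPIEType :=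
  IsPIEType.op (of_isSummand_fiberProd_isOutTree (X := X.op) (Y := Y.op) hX hY.op hZ.op hi.op)

theorem IsConnectedEmbedding.of_isSummand_fiberProd (hX : X.IsConnectedEmbedding)
    (hY : Y.IsConnectedEmbedding) (hZ : Z.quiv.IsConnected) (hi : IsSummand i) :
    Z.IsConnectedEmbedding where
  connected := hZ
  onV_injective v w h := hi.onV_injective (fiberProd_ext_V
    (hX.onV_injective (by simpa using h)) (hY.onV_injective (by simpa using h)))
  onA_injective a b h := hi.onA_injective (fiberProd_ext_A
    (hX.onA_injective (by simpa using h)) (hY.onA_injective (by simpa using h)))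

theorem IsPIEType.of_isSummand_fiberProd [Q.IsAcyclic] (hX : X.IsPIEType) (hY : Y.IsPIEType)
    (hZ : Z.quiv.IsConnected) (hi : IsSummand i) : Z.IsPIEType := by
  have hi' := hi.comp_iso (fiberProdComm X Y)
  obtain hP | hI | hE := id hX
  · exact of_isSummand_fiberProd_isOutTree hP hY hZ hi
  · exact of_isSummand_fiberProd_isInTree hI hY hZ hi
  obtain hP | hI | hE' := hY
  · exact of_isSummand_fiberProd_isOutTree hP hX hZ hi'
  · exact of_isSummand_fiberProd_isInTree hI hX hZ hi'
  · exact .inr (.inr (hE.of_isSummand_fiberProd hE' hZ hi))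

end

/-! ### The terminal object -/

/-- `Q` as a quiver over itself. -/
def terminal (Q : FinQuiver.{u}) : OverQ Q := ⟨Q, FinQuiver.Hom.id Q⟩

theorem card_hom_terminal (Z : OverQ Q) : Nat.card (Z ⟶ terminal Q) = 1 :=
  Nat.card_eq_one_iff_unique.2 ⟨⟨fun f g => hom_ext
    (fun v => (str_onV_hom f v).trans (str_onV_hom g v).symm)
    fun a => (str_onA_hom f a).trans (str_onA_hom g a).symm⟩, ⟨⟨Z.str, rfl⟩⟩⟩

theorem isConnectedEmbedding_of_isSummand_terminal {i : Z ⟶ terminal Q}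
    (hZ : Z.quiv.IsConnected) (hi : IsSummand i) : Z.IsConnectedEmbedding where
  connected := hZ
  onV_injective v w h := hi.onV_injective
    ((str_onV_hom i v).trans (h.trans (str_onV_hom i w).symm))
  onA_injective a b h := hi.onA_injective
    ((str_onA_hom i a).trans (h.trans (str_onA_hom i b).symm))

end OverQ

/-! ### The matrices of a linearization -/

namespace OverQ

variable {Q : FinQuiver.{u}} {X Y Z W : OverQ Q}

/-- The vertices over a vertex of `Q`, indexing the standard basis of the linearization. -/
abbrev VertexFiber (X : OverQ Q) (x : Q.V) : Type u := {y : X.quiv.V // X.str.onV y = x}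

/-- The arrows over an arrow of `Q`. -/
abbrev ArrowFiber (X : OverQ Q) (α : Q.A) : Type u := {b : X.quiv.A // X.str.onA b = α}

/-- The source of an arrow over `α`, as a vertex over the source of `α`. -/
def ArrowFiber.source {α : Q.A} (b : X.ArrowFiber α) : X.VertexFiber (Q.s α) :=
  ⟨X.quiv.s b.1, by rw [← X.str.s_onA, b.2]⟩

/-- The target of an arrow over `α`, as a vertex over the target of `α`. -/
def ArrowFiber.target {α : Q.A} (b : X.ArrowFiber α) : X.VertexFiber (Q.t α) :=
  ⟨X.quiv.t b.1, by rw [← X.str.t_onA, b.2]⟩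

/-- The map between the fibers over a vertex induced by a morphism over `Q`. -/
def VertexFiber.map (f : X ⟶ Y) {x : Q.V} (y : X.VertexFiber x) : Y.VertexFiber x :=
  ⟨f.hom.onV y.1, (str_onV_hom f y.1).trans y.2⟩

/-- The map between the fibers over an arrow induced by a morphism over `Q`. -/
def ArrowFiber.map (f : X ⟶ Y) {α : Q.A} (b : X.ArrowFiber α) : Y.ArrowFiber α :=
  ⟨f.hom.onA b.1, (str_onA_hom f b.1).trans b.2⟩

theorem ArrowFiber.source_map (f : X ⟶ Y) {α : Q.A} (b : X.ArrowFiber α) :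
    (b.map f).source = b.source.map f := Subtype.ext (f.hom.s_onA b.1)

theorem ArrowFiber.target_map (f : X ⟶ Y) {α : Q.A} (b : X.ArrowFiber α) :
    (b.map f).target = b.target.map f := Subtype.ext (f.hom.t_onA b.1)

/-- The number of arrows over `α` from `y` to `z`: an entry of the matrix by which `α` acts on the
linearization. -/
noncomputable def arrowCount (X : OverQ Q) {α : Q.A} (y : X.VertexFiber (Q.s α))
    (z : X.VertexFiber (Q.t α)) : ℕ :=
  Nat.card {b : X.ArrowFiber α // b.source = y ∧ b.target = z}

theorem OutInj.source_injective (hX : X.OutInj) {α : Q.A} :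
    Function.Injective (ArrowFiber.source (X := X) (α := α)) := fun b c h =>
  Subtype.ext (hX (congrArg Subtype.val h) (b.2.trans c.2.symm))

theorem OutInj.arrowCount_source (hX : X.OutInj) {α : Q.A} (b : X.ArrowFiber α)
    (z : X.VertexFiber (Q.t α)) : X.arrowCount b.source z = Finsupp.single b.target 1 z := by
  classical
  rw [Finsupp.single_apply]
  split_ifs with hz
  · exact Nat.card_eq_one_iff_unique.2
      ⟨⟨fun c d => Subtype.ext (hX.source_injective (c.2.1.trans d.2.1.symm))⟩, ⟨⟨b, rfl, hz⟩⟩⟩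
  · refine Nat.card_eq_zero.2 (.inl ⟨fun ⟨c, hs, ht⟩ => hz ?_⟩)
    rw [← ht, hX.source_injective hs]

theorem IsSummand.map_injective {i : Z ⟶ X} (hi : IsSummand i) (x : Q.V) :
    Function.Injective (VertexFiber.map i (x := x)) := fun _ _ h =>
  Subtype.ext (hi.onV_injective (congrArg Subtype.val h))

theorem IsSummand.arrowCount_map {i : Z ⟶ X} (hi : IsSummand i) {α : Q.A}
    (y : Z.VertexFiber (Q.s α)) (z : Z.VertexFiber (Q.t α)) :
    X.arrowCount (y.map i) (z.map i) = Z.arrowCount y z := by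
  refine (Nat.card_congr (Equiv.ofBijective (fun b => ⟨b.1.map i, by rw [b.1.source_map, b.2.1],
    by rw [b.1.target_map, b.2.2]⟩) ⟨fun b c h => ?_, ?_⟩)).symm
  · exact Subtype.ext (Subtype.ext (hi.onA_injective (congrArg (fun b => b.1.1) h)))
  · rintro ⟨⟨a, ha⟩, hs, ht⟩
    obtain ⟨b, rfl⟩ := hi.exists_of_s y.1 a (congrArg Subtype.val hs)
    let b' : Z.ArrowFiber α := ⟨b, (str_onA_hom i b).symm.trans ha⟩
    exact ⟨⟨b', hi.map_injective _ ((b'.source_map i).symm.trans hs),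
      hi.map_injective _ ((b'.target_map i).symm.trans ht)⟩, rfl⟩

theorem IsSummand.arrowCount_eq_zero {i : Z ⟶ X} (hi : IsSummand i) {α : Q.A}
    {y : X.VertexFiber (Q.s α)} {z : X.VertexFiber (Q.t α)}
    (h : ¬ (y.1 ∈ Set.range i.hom.onV ↔ z.1 ∈ Set.range i.hom.onV)) : X.arrowCount y z = 0 := by
  refine Nat.card_eq_zero.2 (.inl ⟨?_⟩)
  rintro ⟨b, rfl, rfl⟩
  refine h ⟨?_, ?_⟩
  · rintro ⟨v, hv⟩
    obtain ⟨c, hc⟩ := hi.exists_of_s v b.1 hv.symm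
    exact ⟨Z.quiv.t c, by rw [← i.hom.t_onA, hc]; rfl⟩
  · rintro ⟨v, hv⟩
    obtain ⟨c, hc⟩ := hi.exists_of_t v b.1 hv.symm
    exact ⟨Z.quiv.s c, by rw [← i.hom.s_onA, hc]; rfl⟩

theorem arrowCount_fiberProd {α : Q.A} (y : X.VertexFiber (Q.s α)) (z : X.VertexFiber (Q.t α))
    (y' : Y.VertexFiber (Q.s α)) (z' : Y.VertexFiber (Q.t α)) :
    (X.fiberProd Y).arrowCount (α := α) ⟨⟨(y.1, y'.1), y.2.trans y'.2.symm⟩, y.2⟩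
      ⟨⟨(z.1, z'.1), z.2.trans z'.2.symm⟩, z.2⟩ = X.arrowCount y z * Y.arrowCount y' z' := by
  rw [arrowCount, arrowCount, arrowCount, ← Nat.card_prod]
  have eq_iff {v w : (X.fiberProd Y).quiv.V} : v = w ↔ v.1.1 = w.1.1 ∧ v.1.2 = w.1.2 :=
    Subtype.ext_iff.trans Prod.ext_iff
  refine Nat.card_congr
    { toFun := fun b =>
        (⟨⟨b.1.1.1.1, b.1.2⟩, ?_, ?_⟩, ⟨⟨b.1.1.1.2, b.1.1.2.symm.trans b.1.2⟩, ?_, ?_⟩)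
      invFun := fun b => ⟨⟨⟨(b.1.1.1, b.2.1.1), b.1.1.2.trans b.2.1.2.symm⟩, b.1.1.2⟩, ?_, ?_⟩
      left_inv := fun _ => rfl
      right_inv := fun _ => rfl }
  · exact Subtype.ext (eq_iff.1 (congrArg Subtype.val b.2.1)).1
  · exact Subtype.ext (eq_iff.1 (congrArg Subtype.val b.2.2)).1
  · exact Subtype.ext (eq_iff.1 (congrArg Subtype.val b.2.1)).2
  · exact Subtype.ext (eq_iff.1 (congrArg Subtype.val b.2.2)).2
  · exact Subtype.ext (eq_iff.2 ⟨congrArg Subtype.val b.1.2.1, congrArg Subtype.val b.2.2.1⟩)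
  · exact Subtype.ext (eq_iff.2 ⟨congrArg Subtype.val b.1.2.2, congrArg Subtype.val b.2.2.2⟩)

end OverQ

section

variable (K : Type u) [Field K] {Q : FinQuiver.{u}} (X : OverQ Q)

/-- The standard basis of the linearization. -/
noncomputable def linBasis (x : Q.V) :
    Module.Basis (X.VertexFiber x) K ((linearization K X).sp x) :=
  Pi.basisFun K (X.VertexFiber x)

theorem linBasis_repr_map {α : Q.A} (y : X.VertexFiber (Q.s α)) (z : X.VertexFiber (Q.t α)) :
    (linBasis K X _).repr ((linearization K X).map α (linBasis K X _ y)) z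
      = X.arrowCount y z := by
  classical
  let _ := Fintype.ofFinite (X.ArrowFiber α)
  have map_apply : (linBasis K X _).repr ((linearization K X).map α (linBasis K X _ y)) z =
      ((∑ b : X.ArrowFiber α, LinearMap.single K (fun _ => K) b.target ∘ₗ LinearMap.id ∘ₗ
        LinearMap.proj (φ := fun _ => K) b.source) (Pi.basisFun K (X.VertexFiber _) y)) z := rfl
  rw [map_apply, LinearMap.sum_apply, Finset.sum_apply]
  rw [OverQ.arrowCount, Nat.card_eq_fintype_card, Fintype.card_subtype, Finset.card_filter,
    Nat.cast_sum]
  refine Finset.sum_congr rfl fun b _ => ?_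
  simp only [LinearMap.comp_apply, LinearMap.id_apply, LinearMap.proj_apply, LinearMap.coe_single,
    Pi.basisFun_apply, Pi.single_apply, Nat.cast_ite, Nat.cast_one, Nat.cast_zero]
  rw [← ite_and]
  exact if_congr (and_comm.trans (and_congr_right' eq_comm)) rfl rfl

theorem finrank_linearization (x : Q.V) :
    Module.finrank K ((linearization K X).sp x) = Nat.card (X.VertexFiber x) :=
  Module.finrank_eq_nat_card_basis (linBasis K X x)

variable {X}

theorem map_linBasis_source (hX : X.OutInj) {α : Q.A} (b : X.ArrowFiber α) :
    (linearization K X).map α (linBasis K X _ b.source) = linBasis K X _ b.target := by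
  refine (linBasis K X _).repr.injective (Finsupp.ext fun z => ?_)
  classical
  rw [linBasis_repr_map, hX.arrowCount_source, Module.Basis.repr_self, Finsupp.single_apply,
    Finsupp.single_apply, Nat.cast_ite, Nat.cast_one, Nat.cast_zero]

theorem support_linearization (hX : X.OutInj) : (linearization K X).support = X.image := by
  ext x
  · refine ⟨fun hx => ?_, fun ⟨y, hy⟩ => ?_⟩
    · have : Nontrivial ((linearization K X).sp x) := hx
      obtain ⟨y⟩ := (linBasis K X x).index_nonempty
      exact ⟨y.1, y.2⟩
    · exact ⟨linBasis K X x ⟨y, hy⟩, 0, (linBasis K X x).ne_zero _⟩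
  · constructor
    · refine not_imp_not.1 fun hα => not_not.2 ((linBasis K X _).ext fun y => ?_)
      refine (linBasis K X _).repr.injective (Finsupp.ext fun z => ?_)
      rw [linBasis_repr_map, OverQ.arrowCount, Nat.card_eq_zero.2 (.inl ⟨fun b => hα ⟨_, b.1.2⟩⟩)]
      simp
    · rintro ⟨b, hb⟩ h
      refine (linBasis K X _).ne_zero (OverQ.ArrowFiber.target ⟨b, hb⟩) ?_
      rw [← map_linBasis_source K hX, h, LinearMap.zero_apply]

end

/-! ### Isomorphisms between linearizations -/

namespace Rep

variable {K : Type u} [Field K] {Q : FinQuiver.{u}}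

theorem nonempty_iso_of_bases {V W : Rep K Q} {ι κ : Q.V → Type*}
    (b : ∀ x, Module.Basis (ι x) K (V.sp x)) (c : ∀ x, Module.Basis (κ x) K (W.sp x))
    (e : ∀ x, ι x ≃ κ x)
    (h : ∀ α i j, (b _).repr (V.map α (b _ i)) j = (c _).repr (W.map α (c _ (e _ i))) (e _ j)) :
    Nonempty (Iso V W) := by
  let app (x : Q.V) : V.sp x ≃ₗ[K] W.sp x :=
    (b x).repr ≪≫ₗ Finsupp.domLCongr (e x) ≪≫ₗ (c x).repr.symm
  have app_basis (x : Q.V) (i : ι x) : app x (b x i) = c x (e x i) := by simp [app]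
  have repr_app (x : Q.V) (v : V.sp x) (i : ι x) :
      (c x).repr (app x v) (e x i) = (b x).repr v i := by
    simp only [app, LinearEquiv.trans_apply, LinearEquiv.apply_symm_apply, Finsupp.domLCongr_apply,
      Finsupp.domCongr_apply, Finsupp.equivMapDomain_apply, Equiv.symm_apply_apply]
  have comm (α : Q.A) : (app (Q.t α)).toLinearMap ∘ₗ V.map α =
      W.map α ∘ₗ (app (Q.s α)).toLinearMap := by
    refine (b _).ext fun i => (c _).repr.injective (Finsupp.ext fun j => ?_)
    obtain ⟨j, rfl⟩ := (e _).surjective j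
    simpa [app_basis, repr_app] using h α i j
  exact ⟨⟨app, fun α => LinearMap.congr_fun (comm α)⟩⟩

/-- The dual representation, obtained by dualizing all spaces and maps. -/
noncomputable def dual (V : Rep K Q) : Rep K Q.op where
  sp (x : Q.V) := Module.Dual K (V.sp x)
  acg (x : Q.V) := inferInstanceAs (AddCommGroup (Module.Dual K (V.sp x)))
  mod (x : Q.V) := inferInstanceAs (Module K (Module.Dual K (V.sp x)))
  fin (x : Q.V) := inferInstanceAs (FiniteDimensional K (Module.Dual K (V.sp x)))
  map (a : Q.A) := (V.map a).dualMap

end Rep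

section

variable (K : Type u) [Field K] {Q : FinQuiver.{u}} {X Y Z W : OverQ Q}

open OverQ

theorem nonempty_iso_linearization (h : Nonempty (X ≅ Y)) :
    Nonempty (Rep.Iso (linearization K X) (linearization K Y)) := by
  obtain ⟨e⟩ := h
  have hV (v : X.quiv.V) : e.inv.hom.onV (e.hom.hom.onV v) = v :=
    congrArg (fun f : X ⟶ X => f.hom.onV v) e.hom_inv_id
  have hV' (v : Y.quiv.V) : e.hom.hom.onV (e.inv.hom.onV v) = v :=
    congrArg (fun f : Y ⟶ Y => f.hom.onV v) e.inv_hom_id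
  refine Rep.nonempty_iso_of_bases (linBasis K X) (linBasis K Y)
    (fun x => ⟨VertexFiber.map e.hom, VertexFiber.map e.inv, fun y => Subtype.ext (hV y.1),
      fun y => Subtype.ext (hV' y.1)⟩) fun α y z => ?_
  rw [linBasis_repr_map, linBasis_repr_map]
  exact congrArg Nat.cast ((isSummand_of_iso e).arrowCount_map y z).symm

theorem nonempty_iso_linearization_dsum {i : Z ⟶ X} {j : W ⟶ X} (hi : IsSummand i)
    (hj : IsSummand j) (hij : Function.Bijective (Sum.elim i.hom.onV j.hom.onV)) :
    Nonempty (Rep.Iso (linearization K X) ((linearization K Z).dsum (linearization K W))) := by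
  have not_mem_range (w : W.quiv.V) : j.hom.onV w ∉ Set.range i.hom.onV := by
    rintro ⟨z, hz⟩
    exact Sum.inl_ne_inr (hij.1 hz)
  have bijective_map (x : Q.V) : Function.Bijective (Sum.elim (VertexFiber.map i (x := x))
      (VertexFiber.map j)) := by
    refine ⟨(hi.map_injective x).sumElim (hj.map_injective x) fun z w h =>
      not_mem_range w.1 ⟨z.1, congrArg Subtype.val h⟩, ?_⟩
    rintro ⟨v, rfl⟩
    obtain ⟨z | w, rfl⟩ := hij.2 v
    · exact ⟨.inl ⟨z, (str_onV_hom i z).symm⟩, rfl⟩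
    · exact ⟨.inr ⟨w, (str_onV_hom j w).symm⟩, rfl⟩
  refine (Rep.nonempty_iso_of_bases (V := (linearization K Z).dsum (linearization K W))
    (fun x => (linBasis K Z x).prod (linBasis K W x)) (linBasis K X)
    (fun x => Equiv.ofBijective _ (bijective_map x)) fun α y z => ?_).map Rep.Iso.symm
  rw [linBasis_repr_map]
  obtain y | y := y <;> obtain z | z := z
  · simp [linBasis_repr_map, hi.arrowCount_map]
  · have arrowCount_eq_zero : X.arrowCount (y.map i) (z.map j) = 0 :=
      hi.arrowCount_eq_zero fun h => not_mem_range z.1 (h.1 ⟨y.1, rfl⟩)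
    simp [arrowCount_eq_zero]
  · have arrowCount_eq_zero : X.arrowCount (y.map j) (z.map i) = 0 :=
      hi.arrowCount_eq_zero fun h => not_mem_range y.1 (h.2 ⟨z.1, rfl⟩)
    simp [arrowCount_eq_zero]
  · simp [linBasis_repr_map, hj.arrowCount_map]

theorem nonempty_iso_linearization_fiberProd (X Y : OverQ Q) :
    Nonempty (Rep.Iso (linearization K (X.fiberProd Y))
      ((linearization K X).tensor (linearization K Y))) := by
  refine (Rep.nonempty_iso_of_bases (V := (linearization K X).tensor (linearization K Y))
    (fun x => (linBasis K X x).tensorProduct (linBasis K Y x)) (linBasis K (X.fiberProd Y))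
    (fun x => ⟨fun y => ⟨⟨(y.1.1, y.2.1), y.1.2.trans y.2.2.symm⟩, y.1.2⟩,
      fun y => (⟨y.1.1.1, y.2⟩, ⟨y.1.1.2, y.1.2.symm.trans y.2⟩), fun _ => rfl, fun _ => rfl⟩)
    fun α y z => ?_).map Rep.Iso.symm
  obtain ⟨y, y'⟩ := y
  obtain ⟨z, z'⟩ := z
  simp only [Module.Basis.tensorProduct_apply, TensorProduct.map_tmul,
    Module.Basis.tensorProduct_repr_tmul_apply, linBasis_repr_map, smul_eq_mul]
  rw [mul_comm, ← Nat.cast_mul]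
  exact congrArg Nat.cast (arrowCount_fiberProd y z y' z').symm

theorem nonempty_iso_linearization_terminal (Q : FinQuiver.{u}) :
    Nonempty (Rep.Iso (linearization K (terminal Q)) (Rep.one K Q)) := by
  have fiber (x : Q.V) : Unique ((terminal Q).VertexFiber x) :=
    ⟨⟨⟨x, rfl⟩⟩, fun y => Subtype.ext y.2⟩
  refine Rep.nonempty_iso_of_bases (linBasis K (terminal Q))
    (fun _ => Module.Basis.singleton PUnit.{1} K) (fun _ => Equiv.ofUnique _ _) fun α y z => ?_
  have card_eq_one : (terminal Q).arrowCount y z = 1 := by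
    refine Nat.card_eq_one_iff_unique.2 ⟨⟨fun b c => Subtype.ext (Subtype.ext ?_)⟩,
      ⟨⟨⟨α, rfl⟩, Subsingleton.elim _ _, Subsingleton.elim _ _⟩⟩⟩
    exact b.1.2.trans c.1.2.symm
  simp [linBasis_repr_map, card_eq_one]

theorem dualBasis_repr_dualMap {M N ι κ : Type*} [AddCommGroup M] [AddCommGroup N] [Module K M]
    [Module K N] [Finite ι] [Finite κ] [DecidableEq ι] [DecidableEq κ] (b : Module.Basis ι K M)
    (c : Module.Basis κ K N) (f : M →ₗ[K] N) (i : ι) (j : κ) :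
    b.dualBasis.repr (f.dualMap (c.dualBasis j)) i = c.repr (f (b i)) j := by
  rw [Module.Basis.dualBasis_repr, LinearMap.dualMap_apply, Module.Basis.dualBasis_apply]

theorem nonempty_iso_dual_linearization (X : OverQ Q) :
    Nonempty (Rep.Iso (linearization K X).dual (linearization K X.op)) := by
  classical
  refine Rep.nonempty_iso_of_bases (V := (linearization K X).dual)
    (fun x : Q.V => (linBasis K X x).dualBasis) (linBasis K X.op) (fun x => Equiv.refl _)
    fun α y z => ?_
  have card_op : X.op.arrowCount (α := α) y z = X.arrowCount z y :=
    Nat.card_congr (Equiv.subtypeEquivRight fun b => and_comm)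
  exact (dualBasis_repr_dualMap K (linBasis K X (Q.s α)) (linBasis K X (Q.t α)) _ z y).trans <|
    (linBasis_repr_map K X z y).trans <| (congrArg Nat.cast card_op.symm).trans
      (linBasis_repr_map K X.op y z).symm

end

/-! ### Duality, projective representations and bricks -/

namespace Rep

variable {K : Type u} [Field K] {Q : FinQuiver.{u}} {U V W : Rep K Q}

/-- Composition of morphisms of representations: first `f`, then `g`. -/
def Hom.comp (f : Hom U V) (g : Hom V W) : Hom U W :=
  ⟨fun x => g.app x ∘ₗ f.app x, fun a v => by simp only [LinearMap.comp_apply, f.comm, g.comm]⟩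

/-- The dual of a morphism of representations. -/
noncomputable def Hom.dual (f : Hom V W) : Hom W.dual V.dual where
  app (x : Q.V) := (f.app x).dualMap
  comm (a : Q.A) (φ : Module.Dual K (W.sp (Q.t a))) :=
    show (φ ∘ₗ W.map a) ∘ₗ f.app (Q.s a) = (φ ∘ₗ f.app (Q.t a)) ∘ₗ V.map a from
      LinearMap.ext fun v => congrArg φ (f.comm a v).symm

/-- The morphism underlying an isomorphism of representations. -/
def Iso.toHom (e : Iso V W) : Hom V W := ⟨fun x => (e.app x).toLinearMap, e.comm⟩

theorem Iso.support_eq (e : Iso V W) : V.support = W.support := by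
  have map_eq_zero {V W : Rep K Q} (e : Iso V W) (α : Q.A) (h : W.map α = 0) : V.map α = 0 :=
    LinearMap.ext fun v => (e.app _).injective (by
      rw [e.comm, h, LinearMap.zero_apply, LinearMap.zero_apply, map_zero])
  ext x
  · exact (e.app x).toEquiv.nontrivial_congr
  · exact not_congr ⟨map_eq_zero e.symm x, map_eq_zero e x⟩

theorem IsProjective.of_iso (hV : V.IsProjective) (e : Iso V W) : W.IsProjective := by
  intro A B g f hg
  obtain ⟨h, hh⟩ := hV A B g (e.toHom.comp f) hg
  exact ⟨e.symm.toHom.comp h, fun x w => (hh x _).trans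
    (congrArg (f.app x) ((e.app x).apply_symm_apply w))⟩

theorem IsInjective.of_iso (hV : V.IsInjective) (e : Iso V W) : W.IsInjective := by
  intro A B g f hg
  obtain ⟨h, hh⟩ := hV A B g (f.comp e.symm.toHom) hg
  exact ⟨h.comp e.toHom, fun x a => (congrArg (e.app x) (hh x a)).trans
    ((e.app x).apply_symm_apply _)⟩

theorem isInjective_of_isProjective_dual (hV : V.dual.IsProjective) : V.IsInjective := by
  intro A B g f hg
  obtain ⟨h, hh⟩ := hV B.dual A.dual g.dual f.dual fun x : Q.V =>
    LinearMap.dualMap_surjective_of_injective (f := g.app x) (hg x)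
  let k (x : Q.V) : Module.Dual K (V.sp x) →ₗ[K] Module.Dual K (B.sp x) := h.app x
  have k_map (α : Q.A) (φ : Module.Dual K (V.sp (Q.t α))) (b : B.sp (Q.s α)) :
      k _ φ (B.map α b) = k _ ((V.map α).dualMap φ) b :=
    (LinearMap.congr_fun (f := k _ ((V.map α).dualMap φ)) (h.comm α φ) b).symm
  have k_app (x : Q.V) (φ : Module.Dual K (V.sp x)) (a : A.sp x) :
      k x φ (g.app x a) = φ (f.app x a) := LinearMap.congr_fun (hh x φ) a
  let l (x : Q.V) : B.sp x →ₗ[K] V.sp x :=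
    (Module.evalEquiv K (V.sp x)).symm.toLinearMap ∘ₗ (k x).dualMap ∘ₗ Module.Dual.eval K (B.sp x)
  have apply_l (x : Q.V) (φ : Module.Dual K (V.sp x)) (b : B.sp x) : φ (l x b) = k x φ b :=
    Module.apply_evalEquiv_symm_apply K (V.sp x) φ _
  have eq_of_dual (x : Q.V) {v w : V.sp x} (hvw : ∀ φ : Module.Dual K (V.sp x), φ v = φ w) :
      v = w := (Module.evalEquiv K (V.sp x)).injective (LinearMap.ext hvw)
  refine ⟨⟨l, fun α b => eq_of_dual _ fun φ => ?_⟩, fun x a => eq_of_dual x fun φ => ?_⟩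
  · rw [apply_l, k_map, ← apply_l, LinearMap.dualMap_apply]
  · rw [apply_l, k_app]

/-- All endomorphisms of `V` are scalar, a condition under which `V` is indecomposable that is easy
to transfer along duality. -/
def HasScalarEnd (V : Rep K Q) : Prop := ∀ p : Hom V V, ∃ c : K, ∀ x v, p.app x v = c • v

theorem HasScalarEnd.of_iso (hV : V.HasScalarEnd) (e : Iso V W) : W.HasScalarEnd := by
  intro p
  obtain ⟨c, hc⟩ := hV ((e.toHom.comp p).comp e.symm.toHom)
  refine ⟨c, fun x w => (e.symm.app x).injective ?_⟩
  have := hc x (e.symm.app x w)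
  rw [map_smul, ← this]
  exact congrArg (fun w => e.symm.app x (p.app x w)) ((e.app x).apply_symm_apply w).symm

theorem HasScalarEnd.of_dual (hV : V.dual.HasScalarEnd) : V.HasScalarEnd := by
  intro p
  obtain ⟨c, hc⟩ := hV p.dual
  refine ⟨c, fun x v => (Module.evalEquiv K (V.sp x)).injective (LinearMap.ext fun φ => ?_)⟩
  change φ (p.app x v) = φ (c • v)
  rw [map_smul]
  exact LinearMap.congr_fun (hc x φ) v

theorem HasScalarEnd.isIndecomposable (hV : V.HasScalarEnd) (h0 : ¬ V.IsZero) :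
    V.IsIndecomposable := by
  refine ⟨h0, fun A B ⟨e⟩ => ?_⟩
  let p : Hom (A.dsum B) (A.dsum B) :=
    ⟨fun x => LinearMap.inl K _ _ ∘ₗ LinearMap.fst K (A.sp x) (B.sp x), fun a v => by simp⟩
  obtain ⟨c, hc⟩ := hV.of_iso e p
  have smul_left (x) (v : A.sp x) : v = c • v := congrArg Prod.fst (hc x (v, 0))
  have smul_right (x) (w : B.sp x) : c • w = 0 := (congrArg Prod.snd (hc x (0, w))).symm
  obtain rfl | hc0 := eq_or_ne c 0
  · exact .inl fun x => ⟨fun v w => by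
      rw [smul_left x v, smul_left x w, zero_smul, zero_smul]⟩
  · exact .inr fun x => ⟨fun v w => by
      rw [(smul_eq_zero.1 (smul_right x v)).resolve_left hc0,
        (smul_eq_zero.1 (smul_right x w)).resolve_left hc0]⟩

end Rep

/-! ### Linearizations of trees and embeddings -/

namespace OverQ

variable {Q : FinQuiver.{u}} {X Y : OverQ Q}

/-- `X`, viewed over the image of its structure map. -/
def toImage (X : OverQ Q) : OverQ X.image.toFinQuiver := ⟨X.quiv, X.toObjE.hom⟩

theorem outInj_toImage (hX : X.OutInj) : X.toImage.OutInj := fun _ _ hs hA =>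
  hX hs (congrArg Subtype.val hA)

theorem outLifts_toImage (hX : X.OutLifts X.image.arrows) : X.toImage.OutLifts Set.univ := by
  intro v α _ hv
  obtain ⟨a, ha, hα⟩ := hX v α.1 α.2 (congrArg Subtype.val hv)
  exact ⟨a, ha, Subtype.ext hα⟩

theorem IsConnectedEmbedding.nonempty_toImage_iso_terminal (hX : X.IsConnectedEmbedding) :
    Nonempty (X.toImage ≅ terminal X.image.toFinQuiver) :=
  nonempty_iso_of_bijective (homMk (X := X.toImage) X.toImage.str (fun _ => rfl) fun _ => rfl)
    ⟨fun _ _ h => hX.onV_injective (congrArg Subtype.val h),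
      by rintro ⟨_, v, rfl⟩; exact ⟨v, rfl⟩⟩
    ⟨fun _ _ h => hX.onA_injective (congrArg Subtype.val h),
      by rintro ⟨_, a, rfl⟩; exact ⟨a, rfl⟩⟩

theorem IsOutTree.onV_injective (hX : X.IsOutTree) (h : X.image = Y.image) {q : Y.quiv.V}
    (hq : Y.op.quiv.IsRoot q) (hXq : Subsingleton (X.VertexFiber (Y.str.onV q))) :
    Function.Injective X.str.onV := by
  have fiber_subsingleton (z : Y.quiv.V) : Subsingleton (X.VertexFiber (Y.str.onV z)) := by
    refine hq.induction (P := fun z => Subsingleton (X.VertexFiber (Y.str.onV z))) hXq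
      (fun b ih => ⟨fun y y' => ?_⟩) z
    change Y.quiv.A at b
    have exists_lift (y : X.VertexFiber (Y.str.onV (Y.quiv.s b))) :
        ∃ a, X.quiv.s a = y ∧ X.str.onA a = Y.str.onA b :=
      hX.outLifts y.1 _ (h ▸ ⟨b, rfl⟩) (by rw [y.2, Y.str.s_onA])
    obtain ⟨a, hay, hab⟩ := exists_lift y
    obtain ⟨a', hay', hab'⟩ := exists_lift y'
    have t_eq : X.quiv.t a = X.quiv.t a' := congrArg Subtype.val <| ih.elim
      ⟨_, by rw [← X.str.t_onA, hab]; exact Y.str.t_onA b⟩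
      ⟨_, by rw [← X.str.t_onA, hab']; exact Y.str.t_onA b⟩
    exact Subtype.ext (by rw [← hay, ← hay', hX.t_injective t_eq])
  intro y y' hy
  obtain ⟨z, hz⟩ : X.str.onV y ∈ Y.image.verts := h ▸ ⟨y, rfl⟩
  exact congrArg Subtype.val ((fiber_subsingleton z).elim ⟨y, hz.symm⟩ ⟨y', by rw [← hy, hz]⟩)

end OverQ

section

variable (K : Type u) [Field K] {Q : FinQuiver.{u}} {X Y : OverQ Q}

open OverQ

theorem nonempty_iso_restrict_image (X : OverQ Q) :
    Nonempty (Rep.Iso (linearization K X.toImage) ((linearization K X).restrict X.image)) := by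
  let e (x : X.image.toFinQuiver.V) : X.toImage.VertexFiber x ≃ X.VertexFiber x.1 :=
    Equiv.subtypeEquivRight fun y => Subtype.ext_iff
  refine Rep.nonempty_iso_of_bases (W := (linearization K X).restrict X.image)
    (linBasis K X.toImage) (fun x => linBasis K X x.1) e fun α y z => ?_
  refine (linBasis_repr_map K X.toImage y z).trans
    ((congrArg Nat.cast ?_).trans (linBasis_repr_map K X _ _).symm)
  exact Nat.card_congr <| Equiv.subtypeEquiv (Equiv.subtypeEquivRight fun b => Subtype.ext_iff)
    fun b => and_congr ((e _).injective.eq_iff (a := b.source)).symm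
      ((e _).injective.eq_iff (a := b.target)).symm

theorem linearization_hom_ext {r : X.quiv.V} (hr : X.quiv.IsRoot r) (hX : X.OutInj) {W : Rep K Q}
    {f g : Rep.Hom (linearization K X) W}
    (h : f.app _ (linBasis K X _ ⟨r, rfl⟩) = g.app _ (linBasis K X _ ⟨r, rfl⟩)) (x : Q.V) :
    f.app x = g.app x := by
  have eq_on_basis (y : X.quiv.V) : ∀ x, (hy : X.str.onV y = x) →
      f.app x (linBasis K X x ⟨y, hy⟩) = g.app x (linBasis K X x ⟨y, hy⟩) := by
    refine hr.induction (P := fun y => ∀ x, (hy : X.str.onV y = x) →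
      f.app x (linBasis K X x ⟨y, hy⟩) = g.app x (linBasis K X x ⟨y, hy⟩))
      (by rintro _ rfl; exact h) (fun a ih x hx => ?_) y
    obtain rfl : Q.t (X.str.onA a) = x := (X.str.t_onA a).trans hx
    rw [show (⟨_, hx⟩ : X.VertexFiber _) = ArrowFiber.target ⟨a, rfl⟩ from rfl,
      ← map_linBasis_source K hX, f.comm, g.comm]
    exact congrArg (W.map _) (ih _ (X.str.s_onA a).symm)
  exact (linBasis K X x).ext fun y => eq_on_basis y.1 x y.2

theorem exists_hom_linearization [Q.IsAcyclic] {r : X.quiv.V} (hr : X.quiv.IsRoot r)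
    (ht : Function.Injective X.quiv.t) (hX : X.OutInj) (hL : X.OutLifts Set.univ) {W : Rep K Q}
    (w : W.sp (X.str.onV r)) :
    ∃ h : Rep.Hom (linearization K X) W, h.app _ (linBasis K X _ ⟨r, rfl⟩) = w := by
  obtain ⟨c, hcr, hc⟩ := hr.exists_rec ht (N := fun y => ∀ x, X.str.onV y = x → W.sp x)
    (fun x hx => hx ▸ w) fun a n x hx =>
      ((X.str.t_onA a).trans hx) ▸ W.map (X.str.onA a) (n _ (X.str.s_onA a).symm)
  have c_target {α : Q.A} (b : X.ArrowFiber α) :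
      c b.target.1 _ b.target.2 = W.map α (c b.source.1 _ b.source.2) := by
    obtain ⟨a, rfl⟩ := b
    exact congrFun (congrFun (hc a) _) _
  let h (x : Q.V) := (linBasis K X x).constr K fun y => c y.1 x y.2
  have h_map (α : Q.A) : h _ ∘ₗ (linearization K X).map α = W.map α ∘ₗ h _ := by
    refine (linBasis K X _).ext fun y => ?_
    obtain ⟨a, ha, rfl⟩ := hL y.1 α trivial y.2.symm
    obtain rfl : ArrowFiber.source ⟨a, rfl⟩ = y := Subtype.ext ha
    rw [LinearMap.comp_apply, LinearMap.comp_apply, map_linBasis_source K hX,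
      Module.Basis.constr_basis, Module.Basis.constr_basis, c_target]
  exact ⟨⟨h, fun α => LinearMap.congr_fun (h_map α)⟩,
    ((linBasis K X _).constr_basis K _ _).trans (congrFun (congrFun hcr _) rfl)⟩

theorem isProjective_linearization [Q.IsAcyclic] {r : X.quiv.V} (hr : X.quiv.IsRoot r)
    (ht : Function.Injective X.quiv.t) (hX : X.OutInj) (hL : X.OutLifts Set.univ) :
    (linearization K X).IsProjective := by
  intro A B g f hg
  obtain ⟨w, hw⟩ := hg _ (f.app _ (linBasis K X _ ⟨r, rfl⟩))
  obtain ⟨h, hh⟩ := exists_hom_linearization K hr ht hX hL w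
  exact ⟨h, fun x => LinearMap.congr_fun <|
    linearization_hom_ext K (f := h.comp g) hr hX ((congrArg (g.app _) hh).trans hw) x⟩

theorem isProjective_linearization_toImage [Q.IsAcyclic] (hX : X.IsOutTree) :
    (linearization K X.toImage).IsProjective := by
  obtain ⟨r, hr⟩ := hX.exists_isRoot
  exact isProjective_linearization K (X := X.toImage) hr hX.t_injective (outInj_toImage hX.outInj)
    (outLifts_toImage hX.outLifts)

theorem OverQ.IsOutTree.isSubprojective [Q.IsAcyclic] (hX : X.IsOutTree) :
    (linearization K X).IsSubprojective := by
  obtain ⟨e⟩ := nonempty_iso_restrict_image K X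
  rw [Rep.IsSubprojective, support_linearization K hX.outInj]
  exact (isProjective_linearization_toImage K hX).of_iso e

theorem OverQ.IsInTree.isSubinjective [Q.IsAcyclic] (hX : X.IsInTree) :
    (linearization K X).IsSubinjective := by
  obtain ⟨e⟩ := nonempty_iso_restrict_image K X
  obtain ⟨d⟩ := nonempty_iso_dual_linearization K X.toImage
  rw [Rep.IsSubinjective,
    support_linearization K (X := X) (.of_s_injective (IsOutTree.t_injective hX))]
  exact (Rep.isInjective_of_isProjective_dual
    ((isProjective_linearization_toImage K (X := X.op) hX).of_iso d.symm)).of_iso e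

theorem OverQ.IsConnectedEmbedding.isIdempotentRep (hX : X.IsConnectedEmbedding) :
    (linearization K X).IsIdempotentRep := by
  obtain ⟨e⟩ := nonempty_iso_restrict_image K X
  obtain ⟨e'⟩ := nonempty_iso_linearization K hX.nonempty_toImage_iso_terminal
  obtain ⟨e''⟩ := nonempty_iso_linearization_terminal K X.image.toFinQuiver
  rw [Rep.IsIdempotentRep, support_linearization K (.of_onA_injective hX.onA_injective)]
  exact ⟨(e.symm.trans e').trans e''⟩

variable {K} in
theorem exists_smul_linBasis {x : Q.V} [Subsingleton (X.VertexFiber x)] (y : X.VertexFiber x)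
    (v : (linearization K X).sp x) : ∃ c : K, v = c • linBasis K X x y := by
  have : Unique (X.VertexFiber x) := ⟨⟨y⟩, fun z => Subsingleton.elim z y⟩
  refine ⟨(linBasis K X x).repr v y, ?_⟩
  conv_lhs => rw [← (linBasis K X x).sum_repr v, Fintype.sum_unique]
  rw [Subsingleton.elim default y]

theorem hasScalarEnd_linearization_of_isRoot [Q.IsAcyclic] {r : X.quiv.V} (hr : X.quiv.IsRoot r)
    (hX : X.OutInj) : (linearization K X).HasScalarEnd := by
  intro p
  have : Subsingleton (X.VertexFiber (X.str.onV r)) := ⟨fun y z => Subtype.ext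
    ((hr.eq_of_onV_eq X.str y.2).trans (hr.eq_of_onV_eq X.str z.2).symm)⟩
  obtain ⟨c, hc⟩ := exists_smul_linBasis ⟨r, rfl⟩ (p.app _ (linBasis K X _ ⟨r, rfl⟩))
  let q : Rep.Hom (linearization K X) (linearization K X) :=
    ⟨fun x => c • LinearMap.id, fun a v => (((linearization K X).map a).map_smul c v).symm⟩
  exact ⟨c, fun x => LinearMap.congr_fun (linearization_hom_ext K (g := q) hr hX hc x)⟩

theorem OverQ.IsConnectedEmbedding.hasScalarEnd (hX : X.IsConnectedEmbedding) :
    (linearization K X).HasScalarEnd := by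
  intro p
  have fiber (x : Q.V) : Subsingleton (X.VertexFiber x) :=
    ⟨fun y z => Subtype.ext (hX.onV_injective (y.2.trans z.2.symm))⟩
  choose c hc using fun y : X.quiv.V =>
    exists_smul_linBasis ⟨y, rfl⟩ (p.app _ (linBasis K X _ ⟨y, rfl⟩))
  have app_linBasis : ∀ (x : Q.V) (y : X.VertexFiber x),
      p.app x (linBasis K X x y) = c y.1 • linBasis K X x y := by
    rintro _ ⟨y, rfl⟩
    exact hc y
  have c_source (a : X.quiv.A) : c (X.quiv.s a) = c (X.quiv.t a) := by
    have h := p.comm _ (linBasis K X _ (ArrowFiber.source ⟨a, rfl⟩))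
    rw [app_linBasis, map_smul, map_linBasis_source K (.of_onA_injective hX.onA_injective),
      app_linBasis] at h
    exact (smul_left_injective K ((linBasis K X _).ne_zero _) h).symm
  have c_eq (y : X.quiv.V) : c y = c hX.connected.1.some :=
    hX.connected.induction (P := (c · = c hX.connected.1.some)) rfl (fun a => by rw [c_source]) y
  exact ⟨c hX.connected.1.some, fun x => LinearMap.congr_fun (g := c _ • LinearMap.id)
    ((linBasis K X x).ext fun y => (app_linBasis x y).trans (by rw [c_eq]; rfl))⟩

theorem OverQ.IsPIEType.hasScalarEnd [Q.IsAcyclic] (hX : X.IsPIEType) :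
    (linearization K X).HasScalarEnd := by
  obtain h | h | h := hX
  · obtain ⟨r, hr⟩ := h.exists_isRoot
    exact hasScalarEnd_linearization_of_isRoot K hr h.outInj
  · obtain ⟨r, hr⟩ := IsOutTree.exists_isRoot h
    obtain ⟨e⟩ := nonempty_iso_dual_linearization K X
    exact ((hasScalarEnd_linearization_of_isRoot K hr h.outInj).of_iso e.symm).of_dual
  · exact h.hasScalarEnd K

theorem OverQ.IsPIEType.isIndecomposable [Q.IsAcyclic] (hX : X.IsPIEType) :
    (linearization K X).IsIndecomposable := by
  refine (hX.hasScalarEnd K).isIndecomposable fun h => ?_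
  have := h (X.str.onV hX.connected.1.some)
  exact (linBasis K X _).ne_zero ⟨hX.connected.1.some, rfl⟩ (Subsingleton.elim _ 0)

variable {K}

theorem subsingleton_vertexFiber (e : Rep.Iso (linearization K X) (linearization K Y)) {x : Q.V}
    (hY : Subsingleton (Y.VertexFiber x)) : Subsingleton (X.VertexFiber x) := by
  rw [← Finite.card_le_one_iff_subsingleton, ← finrank_linearization K] at hY ⊢
  rwa [(e.app x).finrank_eq]

theorem onV_injective_of_iso_linearization (e : Rep.Iso (linearization K X) (linearization K Y))
    (hY : Function.Injective Y.str.onV) : Function.Injective X.str.onV := by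
  intro y z hyz
  have := subsingleton_vertexFiber e (x := X.str.onV z)
    ⟨fun v w => Subtype.ext (hY (v.2.trans w.2.symm))⟩
  exact congrArg Subtype.val (Subsingleton.elim (α := X.VertexFiber _) ⟨y, hyz⟩ ⟨z, rfl⟩)

theorem OverQ.IsOutTree.onV_injective_of_isInTree [Q.IsAcyclic] (hX : X.IsOutTree)
    (hY : Y.IsInTree) (h : X.image = Y.image)
    (e : Rep.Iso (linearization K X) (linearization K Y)) : Function.Injective X.str.onV := by
  obtain ⟨q, hq⟩ := IsOutTree.exists_isRoot hY
  exact hX.onV_injective h hq <| subsingleton_vertexFiber e ⟨fun y z => Subtype.ext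
    ((hq.eq_of_onV_eq Y.op.str y.2).trans (hq.eq_of_onV_eq Y.op.str z.2).symm)⟩

theorem OverQ.IsPIEType.nonempty_iso_of_iso_linearization [Q.IsAcyclic] (hX : X.IsPIEType)
    (hY : Y.IsPIEType) (e : Rep.Iso (linearization K X) (linearization K Y)) :
    Nonempty (X ≅ Y) := by
  have h : X.image = Y.image := by
    rw [← support_linearization K hX.outInj, e.support_eq, support_linearization K hY.outInj]
  by_cases hV : Function.Injective X.str.onV
  · exact (hX.isConnectedEmbedding hV).nonempty_iso_of_image_eq
      (hY.isConnectedEmbedding (onV_injective_of_iso_linearization e.symm hV)) h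
  have hV' : ¬ Function.Injective Y.str.onV := fun h => hV (onV_injective_of_iso_linearization e h)
  obtain hX | hX | hX := hX <;> obtain hY | hY | hY := hY
  · exact hX.nonempty_iso_of_image_eq hY h
  · exact (hV (hX.onV_injective_of_isInTree hY h e)).elim
  · exact (hV' hY.onV_injective).elim
  · exact (hV' (hY.onV_injective_of_isInTree hX h.symm e.symm)).elim
  · exact hX.nonempty_iso_of_image_eq hY h
  all_goals first | exact (hV hX.onV_injective).elim | exact (hV' hY.onV_injective).elim

end

/-! ### Linearizations in the representation ring -/

section

variable {K : Type u} [Field K] {Q : FinQuiver.{u}}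

namespace Rep

theorem Iso.toRing_eq {V W : Rep K Q} (e : Iso V W) : V.toRing = W.toRing :=
  congrArg (fun c => Ideal.Quotient.mk (relIdeal K Q) (FreeAbelianGroup.of c))
    (Quotient.sound ⟨e⟩ : V.cls = W.cls)

theorem toRing_tensor (V W : Rep K Q) : (V.tensor W).toRing = V.toRing * W.toRing := by
  rw [toRing, toRing, toRing, ← map_mul, FreeAbelianGroup.of_mul_of]
  rfl

theorem toRing_dsum (V W : Rep K Q) : (V.dsum W).toRing = V.toRing + W.toRing := by
  rw [toRing, toRing, toRing, ← map_add, Ideal.Quotient.eq, ← sub_sub]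
  exact AddSubgroup.subset_closure ⟨V, W, rfl⟩

theorem IsZero.toRing_eq_zero {V : Rep K Q} (h : V.IsZero) : V.toRing = 0 := by
  have (x : Q.V) : Subsingleton (V.sp x) := h x
  have e : Iso V (V.dsum V) := ⟨fun x => 0, fun a v => Subsingleton.elim _ _⟩
  rw [← add_eq_left (a := V.toRing), ← toRing_dsum, e.toRing_eq]

end Rep

variable (K)

theorem toRing_linearization_disjointUnion {n : ℕ} (w : Fin n → OverQ Q) :
    (linearization K (OverQ.disjointUnion w)).toRing = ∑ k, (linearization K (w k)).toRing := by
  induction n with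
  | zero =>
    rw [Fin.sum_univ_zero]
    have (x : Q.V) : IsEmpty ((OverQ.disjointUnion w).VertexFiber x) := ⟨fun y => y.1.1.elim0⟩
    exact Rep.IsZero.toRing_eq_zero fun x =>
      (linBasis K (OverQ.disjointUnion w) x).repr.toEquiv.subsingleton
  | succ n ih =>
    obtain ⟨e⟩ := nonempty_iso_linearization_dsum K (OverQ.disjointUnion.isSummand_inj (w := w) 0)
      (OverQ.disjointUnion.isSummand_tail w) (OverQ.disjointUnion.bijective_inj_zero_tail w)
    rw [e.toRing_eq, Rep.toRing_dsum, ih, Fin.sum_univ_succ]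

theorem toRing_linearization_fiberProd (X Y : OverQ Q) :
    (linearization K (X.fiberProd Y)).toRing =
      (linearization K X).toRing * (linearization K Y).toRing := by
  obtain ⟨e⟩ := nonempty_iso_linearization_fiberProd K X Y
  rw [e.toRing_eq, Rep.toRing_tensor]

theorem toRing_linearization_terminal : (linearization K (OverQ.terminal Q)).toRing = 1 := by
  obtain ⟨e⟩ := nonempty_iso_linearization_terminal K Q
  exact e.toRing_eq

end

/-! ### Möbius inversion in finite acyclic categories -/

section Moebius

universe v w

variable {C : Type w} [Category.{v} C]

namespace IsAcyclicCategory

theorem homMatrix_self (hC : IsAcyclicCategory C) (x : C) : homMatrix C x x = 1 := by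
  have : Unique (x ⟶ x) := ⟨⟨𝟙 x⟩, hC.endo x⟩
  rw [homMatrix, Nat.card_unique, Nat.cast_one]

theorem eq_of_hom_of_hom (hC : IsAcyclicCategory C) {x y : C} (f : x ⟶ y) (g : y ⟶ x) : x = y :=
  (hC.iso x y f ⟨g, hC.endo x _, hC.endo y _⟩).1

end IsAcyclicCategory

/-- The number of objects strictly below `x` in a finite acyclic category. Nonidentity morphisms
increase it, which makes the Hom matrix triangular. -/
noncomputable def height (x : C) : ℕ := {z : C | z ≠ x ∧ Nonempty (z ⟶ x)}.ncard

/-- The marks of an element of the free abelian group on the objects: the numbers of morphisms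
to it from each object, extended linearly. -/
noncomputable def marks : (C →₀ ℤ) →ₗ[ℤ] (C → ℤ) :=
  Finsupp.linearCombination ℤ (homMatrix C).col

theorem marks_single_one (x z : C) : marks (Finsupp.single x 1) z = Nat.card (z ⟶ x) := by
  rw [marks, Finsupp.linearCombination_single, one_smul, Matrix.col_apply, homMatrix]

theorem marks_eq_mulVec [Fintype C] (n : C →₀ ℤ) : marks n = (homMatrix C).mulVec n := by
  rw [marks, Finsupp.linearCombination_apply, Finsupp.sum_fintype _ _ (by simp),
    Matrix.mulVec_eq_sum]
  simp only [op_smul_eq_smul, Matrix.col]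

namespace IsAcyclicCategory

section

variable [Finite C]

theorem height_lt (hC : IsAcyclicCategory C) {x y : C} (hxy : x ≠ y) (f : x ⟶ y) :
    height x < height y := by
  refine Set.ncard_lt_ncard (Set.ssubset_iff_exists.2
    ⟨?_, x, ⟨hxy, ⟨f⟩⟩, fun h => h.1 rfl⟩) (Set.toFinite _)
  rintro z ⟨-, ⟨g⟩⟩
  refine ⟨?_, ⟨g ≫ f⟩⟩
  rintro rfl
  exact hxy (hC.eq_of_hom_of_hom f g)

theorem homMatrix_eq_zero (hC : IsAcyclicCategory C) {x y : C} (hxy : x ≠ y)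
    (h : height y ≤ height x) : homMatrix C x y = 0 := by
  have : IsEmpty (x ⟶ y) := ⟨fun f => (hC.height_lt hxy f).not_ge h⟩
  rw [homMatrix, Nat.card_of_isEmpty, Nat.cast_zero]

theorem blockTriangular_homMatrix (hC : IsAcyclicCategory C) :
    (homMatrix C).BlockTriangular height := fun _ _ h =>
  hC.homMatrix_eq_zero (by rintro rfl; exact h.false) h.le

end

variable [Fintype C] [DecidableEq C]

theorem det_homMatrix (hC : IsAcyclicCategory C) : (homMatrix C).det = 1 := by
  rw [hC.blockTriangular_homMatrix.det]
  refine Finset.prod_eq_one fun k _ => ?_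
  suffices h : (homMatrix C).toSquareBlock height k = 1 by rw [h, Matrix.det_one]
  ext x y
  rw [Matrix.toSquareBlock_def, Matrix.of_apply, Matrix.one_apply]
  split_ifs with h
  · rw [h, hC.homMatrix_self]
  · exact hC.homMatrix_eq_zero (Subtype.coe_injective.ne h) (y.2.trans x.2.symm).le

theorem isUnit_homMatrix (hC : IsAcyclicCategory C) : IsUnit (homMatrix C) :=
  (Matrix.isUnit_iff_isUnit_det _).2 (hC.det_homMatrix ▸ isUnit_one)

end IsAcyclicCategory

theorem mobius_eq_inv [Fintype C] [DecidableEq C] : mobius C = (homMatrix C)⁻¹ := by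
  unfold mobius
  congr!

namespace IsAcyclicCategory

theorem homMatrix_mul_mobius [Fintype C] [DecidableEq C] (hC : IsAcyclicCategory C) :
    homMatrix C * mobius C = 1 := by
  rw [mobius_eq_inv]
  exact Matrix.mul_nonsing_inv _ (hC.det_homMatrix ▸ isUnit_one)

theorem blockTriangular_mobius [Finite C] (hC : IsAcyclicCategory C) :
    (mobius C).BlockTriangular height := by
  classical
  have := Fintype.ofFinite C
  let := hC.isUnit_homMatrix.invertible
  rw [mobius_eq_inv]
  exact Matrix.blockTriangular_inv_of_blockTriangular hC.blockTriangular_homMatrix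

theorem finsum_card_hom_mul_mobius [Finite C] [DecidableEq C] (hC : IsAcyclicCategory C)
    (x y : C) : ∑ᶠ z, (Nat.card (x ⟶ z) : ℤ) * mobius C z y = (1 : Matrix C C ℤ) x y := by
  have := Fintype.ofFinite C
  rw [finsum_eq_sum_of_fintype, ← hC.homMatrix_mul_mobius, Matrix.mul_apply]
  rfl

theorem mobius_self [Finite C] (hC : IsAcyclicCategory C) (x : C) : mobius C x x = 1 := by
  classical
  have h := hC.finsum_card_hom_mul_mobius x x
  rwa [finsum_eq_single _ x, ← homMatrix, hC.homMatrix_self, one_mul, Matrix.one_apply_eq] at h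
  intro z hz
  by_cases hlt : height x < height z
  · rw [hC.blockTriangular_mobius hlt, mul_zero]
  · rw [← homMatrix, hC.homMatrix_eq_zero hz.symm (not_lt.1 hlt), zero_mul]

theorem marks_delta [Finite C] [DecidableEq C] (hC : IsAcyclicCategory C) (x : C) :
    marks (delta x) = Pi.single x 1 := by
  have := Fintype.ofFinite C
  ext z
  rw [marks_eq_mulVec, Pi.single_apply, ← Matrix.one_apply, ← hC.homMatrix_mul_mobius]
  rfl

theorem bijective_marks [Finite C] (hC : IsAcyclicCategory C) :
    Function.Bijective (marks (C := C)) := by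
  classical
  have := Fintype.ofFinite C
  have h : ⇑(marks (C := C)) = (homMatrix C).mulVec ∘ Finsupp.equivFunOnFinite :=
    funext marks_eq_mulVec
  rw [h]
  exact Function.Bijective.comp ⟨Matrix.mulVec_injective_of_isUnit hC.isUnit_homMatrix,
    Matrix.mulVec_surjective_iff_isUnit.2 hC.isUnit_homMatrix⟩ (Equiv.bijective _)

theorem exists_ringHom_comp_marks_eq [Finite C] (hC : IsAcyclicCategory C) {R : Type*}
    [CommRing R] (L : (C →₀ ℤ) →ₗ[ℤ] R)
    (map_one : ∃ n, L n = 1 ∧ marks n = 1)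
    (map_mul : ∀ x y, ∃ n, L n = L (Finsupp.single x 1) * L (Finsupp.single y 1) ∧
      marks n = marks (Finsupp.single x 1) * marks (Finsupp.single y 1)) :
    ∃ ψ : (C → ℤ) →+* R, ∀ n, ψ (marks n) = L n := by
  let m := LinearEquiv.ofBijective marks hC.bijective_marks
  let ψ : (C → ℤ) →ₗ[ℤ] R := L ∘ₗ m.symm
  have ψ_marks (n : C →₀ ℤ) : ψ (marks n) = L n := congrArg L (m.symm_apply_apply n)
  have bilin : ((LinearMap.mul ℤ (C → ℤ)).compl₁₂ marks marks).compr₂ ψ =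
      (LinearMap.mul ℤ R).compl₁₂ L L := by
    ext x y
    obtain ⟨n, hL, hm⟩ := map_mul x y
    change ψ (marks (Finsupp.single x 1) * marks (Finsupp.single y 1)) = _
    rw [← hm, ψ_marks, hL]
    rfl
  refine ⟨(AlgHom.ofLinearMap ψ ?_ fun a b => ?_ : (C → ℤ) →ₐ[ℤ] R), ψ_marks⟩
  · obtain ⟨n, hL, hm⟩ := map_one
    rw [← hm, ψ_marks, hL]
  · obtain ⟨u, rfl⟩ := hC.bijective_marks.2 a
    obtain ⟨v, rfl⟩ := hC.bijective_marks.2 b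
    rw [ψ_marks, ψ_marks]
    exact LinearMap.congr_fun₂ bilin u v

theorem completeOrthogonalIdempotents_delta [Fintype C] (hC : IsAcyclicCategory C) {R : Type*}
    [CommRing R] {L : (C →₀ ℤ) →ₗ[ℤ] R} {ψ : (C → ℤ) →+* R} (h : ∀ n, ψ (marks n) = L n) :
    CompleteOrthogonalIdempotents fun x : C => L (delta x) := by
  classical
  convert (CompleteOrthogonalIdempotents.single fun _ : C => ℤ).map ψ using 2 with x
  rw [← h, hC.marks_delta, Function.comp_apply]

end IsAcyclicCategory

end Moebius

theorem exists_ringEquiv_pi_span_singleton {ι R : Type*} [Fintype ι] [CommRing R] {e : ι → R}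
    (he : CompleteOrthogonalIdempotents e) :
    ∃ φ : R ≃+* ((i : ι) → (Ideal.span {e i} : Ideal R)), ∀ r i, (φ r i : R) = r * e i := by
  have mem_corner (i : ι) (r : R) : r ∈ Subsemigroup.corner (e i) ↔ r ∈ Ideal.span {e i} := by
    rw [Subsemigroup.mem_corner_iff_mem_range_mul_right (he.idem i)
      (Semigroup.mem_center_iff.2 fun _ => mul_comm _ _), Ideal.mem_span_singleton']
    rfl
  let corner_equiv (i : ι) : (he.idem i).Corner ≃+* (Ideal.span {e i} : Ideal R) :=
    { Equiv.subtypeEquivRight (mem_corner i) with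
      map_mul' := fun _ _ => rfl
      map_add' := fun _ _ => rfl }
  refine ⟨he.ringEquivOfComm.trans (RingEquiv.piCongrRight corner_equiv), fun r i => ?_⟩
  change e i * r * e i = r * e i
  rw [mul_comm (e i) r, mul_assoc, he.idem i]

/-! ### The idempotents of a category of quivers over `Q` -/

section

universe v w

variable {Q : FinQuiver.{u}} {C : Type w} [Category.{v} C] (F : C ⥤ OverQ Q)

/-- The quivers over `Q` that are finite disjoint unions of objects of `F`. -/
def IsDisjointUnionOfObj (X : OverQ Q) : Prop :=
  ∃ (n : ℕ) (w : Fin n → C), Nonempty (X ≅ OverQ.disjointUnion fun k => F.obj (w k))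

variable (K : Type u) [Field K]

/-- The linearization map on the free abelian group on the objects of `F`; for the PIE category
it is `linMap`. -/
noncomputable def linearizationMap : (C →₀ ℤ) →ₗ[ℤ] RepRing K Q :=
  Finsupp.linearCombination ℤ fun x => (linearization K (F.obj x)).toRing

variable {F}

theorem IsDisjointUnionOfObj.exists_linearizationMap_eq_toRing [F.Full] [F.Faithful]
    (hF : ∀ x, (F.obj x).quiv.IsConnected) {X : OverQ Q} (hX : IsDisjointUnionOfObj F X) :
    ∃ n, linearizationMap F K n = (linearization K X).toRing ∧
      ∀ z, marks n z = Nat.card (F.obj z ⟶ X) := by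
  obtain ⟨m, w, ⟨e⟩⟩ := hX
  refine ⟨∑ k, Finsupp.single (w k) 1, ?_, fun z => ?_⟩
  · obtain ⟨i⟩ := nonempty_iso_linearization K ⟨e⟩
    rw [i.toRing_eq, toRing_linearization_disjointUnion, map_sum]
    exact Finset.sum_congr rfl fun k _ => by
      rw [linearizationMap, Finsupp.linearCombination_single, one_smul]
  · rw [Nat.card_congr ((Iso.refl (F.obj z)).homCongr e), OverQ.card_hom_disjointUnion (hF z),
      map_sum, Finset.sum_apply, Nat.cast_sum]
    exact Finset.sum_congr rfl fun k _ => by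
      rw [marks_single_one, Nat.card_congr (Functor.FullyFaithful.ofFullyFaithful F).homEquiv]

theorem IsAcyclicCategory.completeOrthogonalIdempotents_linearizationMap [F.Full] [F.Faithful]
    [Fintype C] (hC : IsAcyclicCategory C) (hF : ∀ x, (F.obj x).quiv.IsConnected)
    (terminal : IsDisjointUnionOfObj F (OverQ.terminal Q))
    (fiberProd : ∀ x y, IsDisjointUnionOfObj F ((F.obj x).fiberProd (F.obj y))) :
    CompleteOrthogonalIdempotents fun x => linearizationMap F K (delta x) := by
  have card_hom (z x : C) : Nat.card (F.obj z ⟶ F.obj x) = Nat.card (z ⟶ x) :=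
    Nat.card_congr (Functor.FullyFaithful.ofFullyFaithful F).homEquiv.symm
  have map_one : ∃ n, linearizationMap F K n = 1 ∧ marks n = 1 := by
    obtain ⟨n, hL, hm⟩ := terminal.exists_linearizationMap_eq_toRing K hF
    refine ⟨n, hL.trans (toRing_linearization_terminal K), funext fun z => ?_⟩
    rw [hm, OverQ.card_hom_terminal, Nat.cast_one, Pi.one_apply]
  have map_mul (x y : C) : ∃ n, linearizationMap F K n =
        linearizationMap F K (Finsupp.single x 1) * linearizationMap F K (Finsupp.single y 1) ∧
      marks n = marks (Finsupp.single x 1) * marks (Finsupp.single y 1) := by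
    obtain ⟨n, hL, hm⟩ := (fiberProd x y).exists_linearizationMap_eq_toRing K hF
    refine ⟨n, ?_, funext fun z => ?_⟩
    · rw [hL, toRing_linearization_fiberProd, linearizationMap,
        Finsupp.linearCombination_single, Finsupp.linearCombination_single, one_smul, one_smul]
    · rw [hm, OverQ.card_hom_fiberProd, card_hom, card_hom, Nat.cast_mul, Pi.mul_apply,
        marks_single_one, marks_single_one]
  obtain ⟨ψ, hψ⟩ := hC.exists_ringHom_comp_marks_eq (linearizationMap F K) map_one map_mul
  exact hC.completeOrthogonalIdempotents_delta hψ

end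

/-! ### The PIE category -/

namespace PIE

variable {Q : FinQuiver.{u}} [Q.IsAcyclic]

theorem isPIEType_obj (x : PIE Q) : ((PIE.incl Q).obj x).IsPIEType :=
  OverQ.isPIEType_of_isPIE (ObjectProperty.FullSubcategory.property _)

theorem exists_obj_iso {X : OverQ Q} (hX : X.IsPIEType) :
    ∃ x : PIE Q, Nonempty (X ≅ (PIE.incl Q).obj x) := by
  obtain ⟨Y, hY, ⟨e⟩⟩ := hX.exists_isPIE
  let y : ObjectProperty.FullSubcategory (C := OverQ Q) (IsPIE Q) := ⟨Y, hY⟩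
  exact ⟨toSkeleton y, ⟨e ≪≫ (ObjectProperty.ι (C := OverQ Q) (IsPIE Q)).mapIso
    (fromSkeletonToSkeletonIso y).symm⟩⟩

variable (Q) in
theorem isAcyclicCategory : IsAcyclicCategory (PIE Q) := by
  have endo (x : PIE Q) (f : x ⟶ x) : f = 𝟙 x := (PIE.incl Q).map_injective
    (((isPIEType_obj x).eq_id _).trans ((PIE.incl Q).map_id x).symm)
  refine ⟨endo, fun x y f _ => ?_⟩
  obtain rfl : x = y := skeleton_skeletal _ ⟨asIso f⟩
  exact ⟨rfl, endo x f⟩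

theorem isDisjointUnionOfObj_of_isPIEType_component {X : OverQ Q}
    (h : ∀ k, (X.component k).IsPIEType) : IsDisjointUnionOfObj (PIE.incl Q) X := by
  obtain ⟨n, k, ⟨e⟩⟩ := X.exists_iso_disjointUnion_components
  choose w hw using fun j => exists_obj_iso (h (k j))
  exact ⟨n, w, ⟨e ≪≫ OverQ.disjointUnion.mapIso fun j => (hw j).some⟩⟩

theorem isDisjointUnionOfObj_fiberProd (x y : PIE Q) : IsDisjointUnionOfObj (PIE.incl Q)
    (((PIE.incl Q).obj x).fiberProd ((PIE.incl Q).obj y)) :=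
  isDisjointUnionOfObj_of_isPIEType_component fun k =>
    (isPIEType_obj x).of_isSummand_fiberProd (isPIEType_obj y)
      (OverQ.isConnected_component _ k) (OverQ.isSummand_componentIncl _ k)

variable (Q) in
theorem isDisjointUnionOfObj_terminal : IsDisjointUnionOfObj (PIE.incl Q) (OverQ.terminal Q) :=
  isDisjointUnionOfObj_of_isPIEType_component fun k => .inr <| .inr <|
    OverQ.isConnectedEmbedding_of_isSummand_terminal
      (OverQ.isConnected_component _ k) (OverQ.isSummand_componentIncl _ k)

variable (K : Type u) [Field K]

variable (Q) in
theorem mainHypotheses : MainHypotheses K (PIE.incl Q) where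
  full := inferInstance
  faithful := inferInstance
  acyclic := isAcyclicCategory Q
  connected x := (isPIEType_obj x).connected
  wrapping x := (isPIEType_obj x).outInj.isWrapping
  fiberProd := isDisjointUnionOfObj_fiberProd
  indecomposable x := (isPIEType_obj x).isIndecomposable K
  distinct x y hxy := by
    rintro ⟨e⟩
    obtain ⟨i⟩ := (isPIEType_obj x).nonempty_iso_of_iso_linearization (isPIEType_obj y) e
    exact hxy (skeleton_skeletal _ ⟨(PIE.incl Q).preimageIso i⟩)

variable (Q) in
theorem completeOrthogonalIdempotents_pieIdem [Fintype (PIE Q)] :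
    CompleteOrthogonalIdempotents (pieIdem (Q := Q) K) :=
  (isAcyclicCategory Q).completeOrthogonalIdempotents_linearizationMap K
    (fun x => (isPIEType_obj x).connected) (isDisjointUnionOfObj_terminal Q)
    isDisjointUnionOfObj_fiberProd

end PIE

end QuiverRep

theorem mainTheorem4 (K : Type u) [Field K] (Q : QuiverRep.FinQuiver.{u}) [Q.IsAcyclic] :
    -- the PIE category satisfies the hypotheses on a category of quivers over `Q`
    QuiverRep.MainHypotheses K (QuiverRep.PIE.incl Q) ∧
    -- the objects linearize to subprojective, subinjective and idempotent indecomposables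
    (∀ (T : QuiverRep.Subquiver Q) (i : T.toFinQuiver.V), T.toFinQuiver.IsUniqueSource i →
      (QuiverRep.linearization K (QuiverRep.objP T i)).IsSubprojective ∧
      (QuiverRep.linearization K (QuiverRep.objP T i)).IsIndecomposable) ∧
    (∀ (T : QuiverRep.Subquiver Q) (i : T.toFinQuiver.V), T.toFinQuiver.IsUniqueSink i →
      (QuiverRep.linearization K (QuiverRep.objI T i)).IsSubinjective ∧
      (QuiverRep.linearization K (QuiverRep.objI T i)).IsIndecomposable) ∧
    (∀ T : QuiverRep.Subquiver Q, T.toFinQuiver.IsConnected →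
      (QuiverRep.linearization K (QuiverRep.objE T)).IsIdempotentRep ∧
      (QuiverRep.linearization K (QuiverRep.objE T)).IsIndecomposable) ∧
    -- the Hom matrix is invertible, with inverse the Möbius function
    (∀ x : QuiverRep.PIE Q, QuiverRep.mobius (QuiverRep.PIE Q) x x = 1) ∧
    (∀ x : QuiverRep.PIE Q, ∑ᶠ z : QuiverRep.PIE Q,
      (Nat.card (x ⟶ z) : ℤ) * QuiverRep.mobius (QuiverRep.PIE Q) z x = 1) ∧
    (∀ x y : QuiverRep.PIE Q, x ≠ y → ∑ᶠ z : QuiverRep.PIE Q,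
      (Nat.card (x ⟶ z) : ℤ) * QuiverRep.mobius (QuiverRep.PIE Q) z y = 0) ∧
    -- the elements `e_x` are idempotent, and `r ↦ (r e_x)_x` is an isomorphism of rings
    (∀ x : QuiverRep.PIE Q, IsIdempotentElem (QuiverRep.pieIdem K x)) ∧
    ∃ φ : QuiverRep.RepRing K Q ≃+*
        ((x : QuiverRep.PIE Q) → (Ideal.span {QuiverRep.pieIdem K x} :
          Ideal (QuiverRep.RepRing K Q))),
      ∀ r x, (φ r x : QuiverRep.RepRing K Q) = r * QuiverRep.pieIdem K x := by
  classical
  have := Fintype.ofFinite (QuiverRep.PIE Q)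
  have hC := QuiverRep.PIE.isAcyclicCategory Q
  have he := QuiverRep.PIE.completeOrthogonalIdempotents_pieIdem Q K
  refine ⟨QuiverRep.PIE.mainHypotheses Q K, fun T i _ => ?_, fun T i _ => ?_, fun T hT => ?_,
    hC.mobius_self, fun x => ?_, fun x y hxy => ?_, he.idem,
    QuiverRep.exists_ringEquiv_pi_span_singleton he⟩
  · have h := QuiverRep.OverQ.isOutTree_objP T i
    exact ⟨h.isSubprojective K, QuiverRep.OverQ.IsPIEType.isIndecomposable K (.inl h)⟩
  · have h := QuiverRep.OverQ.isInTree_objI T i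
    exact ⟨h.isSubinjective K, QuiverRep.OverQ.IsPIEType.isIndecomposable K (.inr (.inl h))⟩
  · have h := QuiverRep.OverQ.isConnectedEmbedding_objE hT
    exact ⟨h.isIdempotentRep K, QuiverRep.OverQ.IsPIEType.isIndecomposable K (.inr (.inr h))⟩
  · rw [hC.finsum_card_hom_mul_mobius, Matrix.one_apply_eq]
  · rw [hC.finsum_card_hom_mul_mobius, Matrix.one_apply_ne hxy]
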